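/- Let $p$ be a prime and let $\mathcal E=(L|K,v)$ be a defect extension of degree $p$: a unibranched valued field extension (the extension of $v$ from $K$ to $L$ is unique) with $[L:K]=p$ and $[L:K]>(vL:vK)[Lv:Kv]$. Valuations are written additively. A subgroup $H$ of an ordered abelian group $\Gamma$ is *strongly convex* if it is a proper convex subgroup and $\Gamma/H$ has no smallest positive element; $\alpha>H$ (resp. $\alpha<H$) means $\alpha>\beta$ (resp. $\alpha<\beta$) for all $\beta\in H$. If $L|K$ is Galois, $\mathcal E$ has *independent defect* if for some strongly convex subgroup $H$ of $vL$ one has $\{v(\frac{\sigma b-b}{b})\mid b\in L^\times\}\setminus\{\infty\}=\{\alpha\in vL\mid\alpha>H\}$ for all $\sigma\in\mathrm{Gal}(L|K)\setminus\{\mathrm{id}\}$. For an element $z$ and a set $S$ put $v(z-S)=\{v(z-c)\mid c\in S\}$, and for $n\in\mathbb N$, $\gamma\in\Gamma$ and a set $S$ of values, $nS=\{ns\mid s\in S\}$, $-S=\{-s\mid s\in S\}$, $\gamma+S=\{\gamma+s\mid s\in S\}$, $\gamma-S=\gamma+(-S)$. Write $\wp(X)=X^p-X$, $\wp(K)=\{\wp(c)\mid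 c\in K\}$, $K^p=\{c^p\mid c\in K\}$. Then $vL=vK$ and the following hold. **1) Artin–Schreier case.** Assume $\mathrm{char}\,K=p$ and $L=K(\vartheta)$ with $\vartheta^p-\vartheta=a\in K$. Then $v(\vartheta-c)<0$ and $v(a-\wp(c))=p\,v(\vartheta-c)$ for all $c\in K$, and therefore $v(a-\wp(K))=p\,v(\vartheta-K)$. The following are equivalent: a) $\mathcal E$ has independent defect; b) $v(\vartheta-K)=-\{\alpha\in vK\mid\alpha>H\}$ for some strongly convex subgroup $H$ of $vK$; c) $v(a-\wp(K))=-\{\alpha\in p\,vK\mid\alpha>H\}$ for some strongly convex subgroup $H$ of $vK$; d) there is a strongly convex subgroup $H$ of $vK$ such that $v(a-\wp(c))<H$ for all $c\in K$, and for all $b\in K$ with $vb>H$ there is $c\in K$ with $v(a-\wp(c))\ge -vb$. If $vK$ is $p$-divisible, these are also equivalent to each of e) $p\,v(\vartheta-K)=v(\vartheta-K)$; f) $v(a-\wp(K))=v(\vartheta-K)$. If $(K,v)$ has rank $1$ (that is, $vK$ is nontrivial and archimedean), the first requirement on $H$ in d) (that $v(a-\wp(c))<H$ for all $c\in K$) may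 be omitted, and the conditions a)–d) are equivalent to g) for all $b\in\mathcal M_K$ there is $c\in K$ with $v(a-\wp(c))\ge -vb$. **2) Kummer case.** Assume that $L|K$ is Galois and $K$ contains a primitive $p$-th root of unity. Then $L=K(\eta)$ for some $1$-unit $\eta$ (that is, $v(\eta-1)>0$) with $\eta^p\in K$, and $\frac{1}{p-1}vp\in vK$. For every such $\eta$, with $a=\eta^p$, we have $v(\eta-c)<\frac1{p-1}vp$ and $v(a-c^p)=p\,v(\eta-c)$ for all $c\in K$, and therefore $v(a-K^p)=p\,v(\eta-K)$. The following are equivalent: a) $\mathcal E$ has independent defect; b) $v(\eta-K)=\frac1{p-1}vp-\{\alpha\in vK\mid\alpha>H\}$ for some strongly convex subgroup $H$ of $vK$; c) $v(a-K^p)=\frac p{p-1}vp-\{\alpha\in p\,vK\mid\alpha>H\}$ for some strongly convex subgroup $H$ of $vK$; d) there is a strongly convex subgroup $H$ of $vK$ such that $v(a-c^p)-\frac p{p-1}vp<H$ for all $c\in K$, and for all $b\in K$ with $vb>H$ there is $c\in K$ with $v(a-c^p)\ge\frac p{p-1}vp-vb$. If $vK$ is $p$-divisible, these are also equivalent to each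 of e) $p\,v(\eta-K)=vp+v(\eta-K)$; f) $v(a-K^p)=vp+v(\eta-K)$. If $(K,v)$ has rank $1$, the first requirement on $H$ in d) (that $v(a-c^p)-\frac p{p-1}vp<H$ for all $c\in K$) may be omitted, and the conditions a)–d) are equivalent to g) for all $b\in\mathcal M_K$ there is $c\in K$ with $v(a-c^p)\ge\frac p{p-1}vp-vb$. -/

import Mathlib

open scoped Pointwise IntermediateField

noncomputable section

namespace DefectExt

/-! ### Ordered abelian groups -/

section OrderedGroup

variable {G : Type*} [AddCommGroup G] [LinearOrder G]

/-- `{α ∈ G | α > H}`, where `α > H` means `α > β` for all `β ∈ H`. -/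
def above (H : AddSubgroup G) : Set G := {α | ∀ β ∈ H, β < α}

/-- A strongly convex subgroup `H` of `G`: a proper convex subgroup such that `G / H`, ordered by
`α + H < β + H ↔ β - α > H`, has no smallest positive element. The positive elements of `G / H`
are the cosets `α + H` with `α > H`. -/
structure IsStronglyConvex (H : AddSubgroup G) : Prop where
  proper : H ≠ ⊤
  convex : (H : Set G).OrdConnected
  no_least_pos : ∀ α ∈ above H, ∃ β ∈ above H, α - β ∈ above H

/-- `G` is `p`-divisible. -/
def IsPDivisible (p : ℕ) (G : Type*) [AddCommGroup G] : Prop := ∀ α : G, ∃ β : G, p • β = α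

/-- `G` has rank one: it is nontrivial and archimedean. -/
def IsRankOne (G : Type*) [AddCommGroup G] [LinearOrder G] : Prop :=
  Nontrivial G ∧ Archimedean G

end OrderedGroup

/-! ### Valued fields, with valuations written additively -/

section Valued

variable {Γ : Type*} [AddCommGroup Γ] [LinearOrder Γ] [IsOrderedAddMonoid Γ]

/-- The value group `vF` of a valued field `(F, v)`, as a subgroup of `Γ`. -/
def valueGroup {F : Type*} [Field F] (v : AddValuation F (WithTop Γ)) : AddSubgroup Γ where
  carrier := {γ | ∃ x : F, v x = (γ : WithTop Γ)}
  zero_mem' := ⟨1, by simp⟩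
  add_mem' := by
    rintro a b ⟨x, hx⟩ ⟨y, hy⟩
    exact ⟨x * y, by rw [v.map_mul, hx, hy, WithTop.coe_add]⟩
  neg_mem' := by
    rintro a ⟨x, hx⟩
    refine ⟨x⁻¹, ?_⟩
    have hx0 : x ≠ 0 := by
      rintro rfl
      simp at hx
    have h : v x⁻¹ + v x = 0 := by
      rw [← v.map_mul, inv_mul_cancel₀ hx0, v.map_one]
    rw [hx] at h
    generalize v x⁻¹ = t at h
    induction t using WithTop.recTopCoe with
    | top => simp at h
    | coe t =>
      rw [← WithTop.coe_add, ← WithTop.coe_zero, WithTop.coe_inj] at h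
      rw [eq_neg_of_add_eq_zero_left h]

/-- The valuation ring of `(F, v)`. -/
abbrev valuationRing {F : Type*} [Field F] (v : AddValuation F (WithTop Γ)) :
    ValuationSubring F :=
  (AddValuation.toValuation v).valuationSubring

variable (K : Type*) {L : Type*} [Field K] [Field L] [Algebra K L]

/-- The restriction to `K` of a valuation `v` on `L`. -/
abbrev restr (v : AddValuation L (WithTop Γ)) : AddValuation K (WithTop Γ) :=
  v.comap (algebraMap K L)

instance restr_hasExtension (v : AddValuation L (WithTop Γ)) :
    (AddValuation.toValuation (restr K v)).HasExtension (AddValuation.toValuation v) where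
  val_isEquiv_comap := fun _ _ => Iff.rfl

/-- The ramification index `(vL : vK)`. -/
def ramificationIndex (v : AddValuation L (WithTop Γ)) : ℕ :=
  (valueGroup (restr K v)).relIndex (valueGroup v)

/-- The residue degree `[Lv : Kv]`. -/
def residueDegree (v : AddValuation L (WithTop Γ)) : ℕ :=
  Module.finrank (IsLocalRing.ResidueField (valuationRing (restr K v)))
    (IsLocalRing.ResidueField (valuationRing v))

/-- `(L|K, v)` is unibranched: the extension of `v` from `K` to `L` is unique (up to equivalence,
so every valuation ring of `L` lying over that of `K` is that of `L`). -/
def IsUnibranched (v : AddValuation L (WithTop Γ)) : Prop :=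
  ∀ A : ValuationSubring L,
    A.comap (algebraMap K L) = valuationRing (restr K v) → A = valuationRing v

/-- The defect `d(L|K, v)`, given by `[L : K] = d(L|K, v) · (vL : vK) · [Lv : Kv]`. -/
def defect (v : AddValuation L (WithTop Γ)) : ℚ :=
  (Module.finrank K L : ℚ) / (ramificationIndex K v * residueDegree K v)

/-- `(L|K, v)` is a finite unibranched extension with defect greater than `1`. -/
structure IsDefectExtension (v : AddValuation L (WithTop Γ)) : Prop where
  finite : FiniteDimensional K L
  unibranched : IsUnibranched K v
  one_lt_defect : 1 < defect K v

/-- `Σ_σ = {v((σ b - b) / b) | b ∈ L, b ≠ 0}`, as a subset of `vL` (so without `∞`). -/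
def sigmaSet {K : Type*} [Field K] [Algebra K L] (v : AddValuation L (WithTop Γ))
    (σ : L ≃ₐ[K] L) : Set (valueGroup v) :=
  {γ | ∃ b : L, b ≠ 0 ∧ v ((σ b - b) / b) = ((γ : Γ) : WithTop Γ)}

/-- The Galois defect extension `(L|K, v)` of prime degree has independent defect: for some
strongly convex subgroup `H` of `vL`, we have `Σ_σ = {α ∈ vL | α > H}` for all `σ ≠ id` in the
Galois group. -/
def HasIndependentDefect (v : AddValuation L (WithTop Γ)) : Prop :=
  ∃ H : AddSubgroup (valueGroup v), IsStronglyConvex H ∧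
    ∀ σ : L ≃ₐ[K] L, σ ≠ 1 → sigmaSet v σ = above H

/-- `v(z - S) = {v(z - c) | c ∈ S}`. -/
def valSet {F : Type*} [Field F] (v : AddValuation F (WithTop Γ)) (z : F) (S : Set F) :
    Set (WithTop Γ) :=
  (fun c => v (z - c)) '' S

/-- `n S = {n s | s ∈ S}`. -/
def mulSet {M : Type*} [AddMonoid M] (n : ℕ) (S : Set M) : Set M := (fun s => n • s) '' S

/-- `γ + S = {γ + s | s ∈ S}`. -/
def addSet {M : Type*} [Add M] (γ : M) (S : Set M) : Set M := (fun s => γ + s) '' S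

/-- `{α ∈ nG | α > H}`. -/
def aboveMul {G : Type*} [AddCommGroup G] [LinearOrder G] (n : ℕ) (H : AddSubgroup G) : Set G :=
  {α | (∃ β : G, n • β = α) ∧ α ∈ above H}

/-- `x > H` for a value `x` in `Γ ∪ {∞}`. -/
def valGT {G : AddSubgroup Γ} (x : WithTop Γ) (H : AddSubgroup G) : Prop :=
  ∀ h ∈ H, ((h : Γ) : WithTop Γ) < x

/-- `x < H` for a value `x` in `Γ ∪ {∞}`. -/
def valLT {G : AddSubgroup Γ} (x : WithTop Γ) (H : AddSubgroup G) : Prop :=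
  ∀ h ∈ H, x < ((h : Γ) : WithTop Γ)

/-- A subset of a subgroup `G` of `Γ`, viewed as a set of values in `Γ ∪ {∞}`. -/
def toValues {G : AddSubgroup Γ} (S : Set G) : Set (WithTop Γ) :=
  (fun α : G => ((α : Γ) : WithTop Γ)) '' S

end Valued

/-- The Artin-Schreier polynomial `℘(X) = X ^ p - X`, as a function. -/
def wp {R : Type*} [CommRing R] (p : ℕ) (x : R) : R := x ^ p - x

end DefectExt

end

noncomputable section

namespace DefectExt

open Polynomial IsLocalRing Filter

/-! ### Unibranched extensions: integrality, norms and invariance of the valuation. -/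

section Valued
variable {Γ : Type*} [AddCommGroup Γ] [LinearOrder Γ] [IsOrderedAddMonoid Γ]
variable {K L : Type*} [Field K] [Field L] [Algebra K L]

/-! Everything reduces to one set of positive values. Let `δ` be the common value of `σ ϑ - ϑ` for
`σ ≠ 1`: it is `0` for an Artin–Schreier generator and `vp/(p-1)` for a Kummer generator that is a
`1`-unit. Put `A = δ - v(ϑ - K)` (`distSet`). The extension is immediate, so `v(ϑ - K)` is an
initial segment of `vK` without maximum, and it lies below `δ`; thus `A` is a final segment of
positive elements.

The heart is `Σ_σ = A` (`mem_sigmaSet_iff`). The elements `b = ϑ - c` realise all of `A`.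
Conversely, write `b = f(ϑ)` with `deg f < p`. A Kaplansky-type argument (`eventually_val_aeval_eq`)
shows that `v(f(c))` and `v(f'(c))` eventually equal their values at `ϑ` as `c` approaches `ϑ`. Then
`f` is linear near `ϑ` as far as values are concerned, so `v(σ b - b) = v(f'(ϑ)) + δ` and `v b ≤
v(f'(ϑ)) + v(ϑ - c)` for some `c`. Hence `v((σ b - b)/b) ≥ δ - v(ϑ - c)`, which lies in the final
segment `A`.

Independent defect therefore means `A = {α > H}` for a strongly convex `H`. Since `v(a - F(c)) = p
v(ϑ - c)` with `F = ℘` or `F(c) = c ^ p`, the remaining conditions become statements about `A` in an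
ordered group: passing to `pA`, coinitiality (`eq_above_iff_coinitial`), `pA = A`
(`exists_eq_above_iff_mulSet_eq`), and `H = 0` in rank one (`rankOne_tfae`). -/

theorem mem_valuationRing {F : Type*} [Field F] {v : AddValuation F (WithTop Γ)} {x : F} :
    x ∈ valuationRing v ↔ 0 ≤ v x := Iff.rfl

theorem restr_apply (v : AddValuation L (WithTop Γ)) (c : K) :
    restr K v c = v (algebraMap K L c) := rfl

open Algebra in
-- If `x` were not integral, the maximal ideal of `R` and `x⁻¹` would generate a proper ideal of
-- `R[x⁻¹]`. A valuation ring dominating it lies over `R` and omits `x`, so it is a second extension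
-- of the valuation.
theorem IsUnibranched.isIntegral {v : AddValuation L (WithTop Γ)} (hU : IsUnibranched K v)
    {x : L} (hx : 0 ≤ v x) : IsIntegral (valuationRing (restr K v)) x := by
  by_contra hxR
  set R := valuationRing (restr K v) with hR
  have hx0 : x ≠ 0 := by
    rintro rfl
    exact hxR isIntegral_zero
  let := invertibleOfNonzero hx0
  let B := R[x⁻¹]
  let xinv : B.toSubring := ⟨x⁻¹, subset_adjoin rfl⟩
  have hne : (maximalIdeal R).map (algebraMap _ B) ⊔ .span {xinv} ≠ ⊤ := fun eq ↦ hxR <| by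
    have ⟨p, hp, hpx⟩ := exists_aeval_invOf_eq_zero_of_idealMap_adjoin_sup_span_eq_top _ _
      (maximalIdeal.isMaximal R).ne_top eq
    have H : IsUnit p.leadingCoeff := of_not_not fun h ↦ by simpa using sub_mem h hp
    refine ⟨.C H.unit⁻¹.1 * p, by simp [Polynomial.Monic], ?_⟩
    rw [← Polynomial.aeval_def]
    rw [invOf_eq_inv, inv_inv] at hpx
    rw [map_mul, hpx, mul_zero]
  have ⟨V, hV⟩ := Ideal.image_subset_nonunits_valuationSubring (A := B.toSubring) _ hne
  have hVR : V.comap (algebraMap K L) = R := by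
    ext c
    constructor
    · intro hc
      by_contra hcR
      have hc0 : c ≠ 0 := by rintro rfl; exact hcR (zero_mem _)
      have hci : c⁻¹ ∈ R := (R.mem_or_inv_mem c).resolve_left hcR
      have hcm : (⟨c⁻¹, hci⟩ : R) ∈ maximalIdeal R := by
        rw [mem_maximalIdeal, mem_nonunits_iff]
        intro hu
        obtain ⟨y, hy⟩ := isUnit_iff_exists_inv.mp hu
        have : c = y := by
          have := congrArg Subtype.val hy
          simp only [MulMemClass.coe_mul, OneMemClass.coe_one] at this
          field_simp at this
          exact this.symm
        exact hcR (this ▸ y.2)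
      have h1 : algebraMap K L c⁻¹ ∈ V.nonunits :=
        hV.2 ⟨_, Ideal.mem_sup_left (Ideal.mem_map_of_mem _ hcm), rfl⟩
      rw [map_inv₀, V.inv_mem_nonunits_iff] at h1
      rcases h1 with h1 | h1
      · exact hc0 ((map_eq_zero _).mp h1)
      · exact h1 hc
    · intro hc
      exact hV.1 (B.algebraMap_mem ⟨c, hc⟩)
  have hVv := hU V hVR
  have h2 := (V.inv_mem_nonunits_iff.mp <|
      hV.2 ⟨_, Ideal.mem_sup_right (Ideal.subset_span rfl), rfl⟩).resolve_left hx0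
  exact h2 (hVv ▸ hx)

theorem IsUnibranched.coeff_minpoly_nonneg {v : AddValuation L (WithTop Γ)}
    (hU : IsUnibranched K v) {x : L} (hx : 0 ≤ v x) (i : ℕ) :
    0 ≤ restr K v ((minpoly K x).coeff i) := by
  rw [minpoly.isIntegrallyClosed_eq_field_fractions' K (hU.isIntegral hx), coeff_map]
  exact ((minpoly (valuationRing (restr K v)) x).coeff i).2

/-- Up to sign the norm is a power of the constant term of the minimal polynomial. That term is `-x`
times a polynomial in `x` with integral coefficients. -/
theorem IsUnibranched.norm_pos [FiniteDimensional K L] {v : AddValuation L (WithTop Γ)}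
    (hU : IsUnibranched K v) {x : L} (hx : 0 < v x) : 0 < restr K v (Algebra.norm K x) := by
  set g := minpoly K x with hg
  have hint : IsIntegral K x := Algebra.IsIntegral.isIntegral x
  have hc0 : 0 < restr K v (g.coeff 0) := by
    have h1 : aeval x g = 0 := minpoly.aeval K x
    rw [← divX_mul_X_add g, map_add, map_mul, aeval_X, aeval_C] at h1
    have h2 : algebraMap K L (g.coeff 0) = -(aeval x g.divX * x) := by
      linear_combination h1
    rw [restr_apply, h2, v.map_neg, v.map_mul]
    refine lt_of_lt_of_le hx (le_add_of_nonneg_left ?_)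
    rw [aeval_eq_sum_range]
    refine v.map_le_sum fun i _ ↦ ?_
    rw [Algebra.smul_def, v.map_mul, v.map_pow]
    refine add_nonneg ?_ (nsmul_nonneg hx.le _)
    rw [coeff_divX]
    exact hU.coeff_minpoly_nonneg hx.le _
  have hN := Algebra.norm_eq_prod_roots (K := K) (L := L) (F := AlgebraicClosure L) (x := x)
    (IsAlgClosed.splits _)
  have hk : Module.finrank K⟮x⟯ L ≠ 0 := Module.finrank_pos.ne'
  set k := Module.finrank K⟮x⟯ L
  have hr : algebraMap K (AlgebraicClosure L) (g.coeff 0) =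
      (-1) ^ g.natDegree * ((g.aroots (AlgebraicClosure L)).prod) := by
    have hm : (g.map (algebraMap K (AlgebraicClosure L))).Monic := (minpoly.monic hint).map _
    have := (IsAlgClosed.splits (g.map (algebraMap K (AlgebraicClosure L)))).coeff_zero_eq_prod_roots_of_monic hm
    rw [coeff_map, natDegree_map] at this
    exact this
  have hN' : Algebra.norm K x = ((-1) ^ g.natDegree * g.coeff 0) ^ k := by
    apply (algebraMap K (AlgebraicClosure L)).injective
    rw [hN, map_pow, map_mul, hr, ← mul_assoc, map_pow, map_neg, map_one, ← mul_pow]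
    simp [hg]
  rw [hN', AddValuation.map_pow]
  have h1 : restr K v ((-1) ^ g.natDegree * g.coeff 0) = restr K v (g.coeff 0) := by
    rcases neg_one_pow_eq_or K g.natDegree with h | h <;> rw [h]
    · rw [one_mul]
    · rw [neg_one_mul, AddValuation.map_neg]
  rw [h1]
  exact lt_of_lt_of_le hc0 (le_self_nsmul hc0.le hk)

theorem coe_ne_zero_of_val {F : Type*} [Field F] {v : AddValuation F (WithTop Γ)} {x : F} {γ : Γ}
    (h : v x = γ) : x ≠ 0 := by
  rintro rfl
  simp at h

theorem exists_val {F : Type*} [Field F] (v : AddValuation F (WithTop Γ)) {x : F} (hx : x ≠ 0) :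
    ∃ γ : Γ, v x = γ := by
  have := (v.ne_top_iff).mpr hx
  exact ⟨(v x).untop this, by simp⟩

theorem val_inv {F : Type*} [Field F] {v : AddValuation F (WithTop Γ)} {x : F} {γ : Γ}
    (h : v x = γ) : v x⁻¹ = ((-γ : Γ) : WithTop Γ) := by
  have hx := coe_ne_zero_of_val h
  obtain ⟨δ, hδ⟩ := exists_val v (inv_ne_zero hx)
  have : v (x * x⁻¹) = 0 := by rw [mul_inv_cancel₀ hx, v.map_one]
  rw [v.map_mul, h, hδ] at this
  rw [hδ]
  norm_cast at this ⊢
  exact (neg_eq_of_add_eq_zero_right this).symm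

theorem val_div {F : Type*} [Field F] {v : AddValuation F (WithTop Γ)} {x y : F} {γ δ : Γ}
    (hx : v x = γ) (hy : v y = δ) : v (x / y) = ((γ - δ : Γ) : WithTop Γ) := by
  rw [div_eq_mul_inv, v.map_mul, hx, val_inv hy, sub_eq_add_neg, WithTop.coe_add]

theorem IsUnibranched.val_eq_zero_of_norm_eq_one [FiniteDimensional K L]
    {v : AddValuation L (WithTop Γ)} (hU : IsUnibranched K v) {x : L}
    (hx : Algebra.norm K x = 1) : v x = 0 := by
  have hx0 : x ≠ 0 := by
    rintro rfl
    rw [Algebra.norm_zero] at hx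
    exact zero_ne_one hx
  obtain ⟨γ, hγ⟩ := exists_val v hx0
  rcases lt_trichotomy γ 0 with h | h | h
  · have h1 : 0 < v x⁻¹ := by
      rw [val_inv hγ]
      exact_mod_cast neg_pos.mpr h
    have := hU.norm_pos h1
    rw [Algebra.norm_inv, hx, inv_one, AddValuation.map_one] at this
    exact absurd this (lt_irrefl _)
  · rw [hγ, h]; rfl
  · have h1 : 0 < v x := by
      rw [hγ]
      exact_mod_cast h
    have := hU.norm_pos h1
    rw [hx, AddValuation.map_one] at this
    exact absurd this (lt_irrefl _)

theorem IsUnibranched.restr_norm [FiniteDimensional K L] {v : AddValuation L (WithTop Γ)}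
    (hU : IsUnibranched K v) (x : L) :
    restr K v (Algebra.norm K x) = Module.finrank K L • v x := by
  have hn : Module.finrank K L ≠ 0 := Module.finrank_pos.ne'
  by_cases hx : x = 0
  · rw [hx, Algebra.norm_zero, AddValuation.map_zero, AddValuation.map_zero]
    obtain ⟨m, hm⟩ := Nat.exists_eq_succ_of_ne_zero hn
    rw [hm, succ_nsmul, add_top]
  set n := Module.finrank K L
  have hN0 : Algebra.norm K x ≠ 0 := Algebra.norm_ne_zero_iff.mpr hx
  -- Dividing `x ^ n` by the norm of `x` gives an element of norm `1`, hence of value `0`.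
  have h1 : v (x ^ n * algebraMap K L (Algebra.norm K x)⁻¹) = 0 := by
    apply hU.val_eq_zero_of_norm_eq_one
    rw [map_mul, map_pow, Algebra.norm_algebraMap, ← mul_pow, mul_inv_cancel₀ hN0, one_pow]
  obtain ⟨γ, hγ⟩ := exists_val (restr K v) hN0
  obtain ⟨δ, hδ⟩ := exists_val v hx
  rw [v.map_mul, ← restr_apply, val_inv hγ, v.map_pow, hδ] at h1
  rw [hγ, hδ]
  norm_cast at h1 ⊢
  rw [← sub_eq_add_neg, sub_eq_zero] at h1
  exact h1.symm

theorem nsmul_coe_injective {n : ℕ} (hn : n ≠ 0) {a b : WithTop Γ} (h : n • a = n • b) :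
    a = b := by
  obtain ⟨m, rfl⟩ := Nat.exists_eq_succ_of_ne_zero hn
  induction a using WithTop.recTopCoe <;> induction b using WithTop.recTopCoe
  · rfl
  · rw [succ_nsmul, add_top, ← WithTop.coe_nsmul] at h
    exact absurd h WithTop.top_ne_coe
  · rw [succ_nsmul (⊤ : WithTop Γ), add_top, ← WithTop.coe_nsmul] at h
    exact absurd h WithTop.coe_ne_top
  · norm_cast at h ⊢
    exact nsmul_right_injective (Nat.succ_ne_zero m) h

theorem IsUnibranched.val_algEquiv [FiniteDimensional K L] {v : AddValuation L (WithTop Γ)}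
    (hU : IsUnibranched K v) (σ : L ≃ₐ[K] L) (x : L) : v (σ x) = v x := by
  apply nsmul_coe_injective (Module.finrank_pos (R := K) (M := L)).ne'
  rw [← hU.restr_norm, ← hU.restr_norm, Algebra.norm_eq_of_algEquiv]

end Valued

/-! ### Defect extensions of prime degree are immediate. -/

section Valued
variable {Γ : Type*} [AddCommGroup Γ] [LinearOrder Γ] [IsOrderedAddMonoid Γ]
variable {K L : Type*} [Field K] [Field L] [Algebra K L]

theorem valueGroup_restr_le (v : AddValuation L (WithTop Γ)) :
    valueGroup (restr K v) ≤ valueGroup v := by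
  rintro γ ⟨c, hc⟩
  exact ⟨algebraMap K L c, hc⟩

theorem IsUnibranched.finrank_nsmul_mem [FiniteDimensional K L] {v : AddValuation L (WithTop Γ)}
    (hU : IsUnibranched K v) {γ : Γ} (hγ : γ ∈ valueGroup v) :
    Module.finrank K L • γ ∈ valueGroup (restr K v) := by
  obtain ⟨x, hx⟩ := hγ
  exact ⟨Algebra.norm K x, by rw [hU.restr_norm, hx, WithTop.coe_nsmul]⟩

/-- A subgroup of a commutative group of finite index less than `p` which contains all `p`-th
multiples is the whole group. -/
theorem eq_top_of_nsmul_mem {G : Type*} [AddCommGroup G] {p : ℕ} (hp : p.Prime)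
    {H : AddSubgroup G} (hH : ∀ x : G, p • x ∈ H) (h0 : H.index ≠ 0) (h1 : H.index < p) :
    H = ⊤ := by
  rw [eq_top_iff]
  intro x _
  have h2 : H.index • x ∈ H := AddSubgroup.nsmul_index_mem H x
  have hc : Nat.Coprime H.index p :=
    ((Nat.coprime_of_lt_prime h0 h1 hp).symm)
  have hb := Nat.gcd_eq_gcd_ab H.index p
  rw [hc] at hb
  have : x = H.index.gcdA p • (H.index • x) + H.index.gcdB p • (p • x) := by
    rw [← natCast_zsmul, ← natCast_zsmul (n := p), ← mul_zsmul, ← mul_zsmul, ← add_zsmul,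
      mul_comm (Nat.gcdA _ _), mul_comm (Nat.gcdB _ _), ← hb]
    simp
  rw [this]
  exact H.add_mem (H.zsmul_mem h2 _) (H.zsmul_mem (hH x) _)

theorem mem_adjoin_inv_of_isIntegral {R F : Type*} [CommRing R] [Field F] [Algebra R F] {y : F}
    (hy : IsIntegral R y) : y ∈ Algebra.adjoin R {y⁻¹} := by
  by_cases h0 : y = 0
  · rw [h0]; exact zero_mem _
  obtain ⟨P, hP, hPy⟩ := hy
  let := invertibleOfNonzero h0
  have h1 := (eval₂_reverse_eq_zero_iff (algebraMap R F) y P).mpr hPy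
  rw [invOf_eq_inv, ← divX_mul_X_add P.reverse, coeff_zero_reverse, hP.leadingCoeff, map_one,
    eval₂_add, eval₂_mul, eval₂_X, eval₂_one, ← aeval_def] at h1
  have h2 : y = -aeval y⁻¹ P.reverse.divX := by
    linear_combination y * h1 - (aeval y⁻¹ P.reverse.divX) * mul_inv_cancel₀ h0
  have h3 : -aeval y⁻¹ P.reverse.divX ∈ Algebra.adjoin R {y⁻¹} :=
    neg_mem (aeval_mem_adjoin_singleton _ _)
  rwa [← h2] at h3

/-- The elements of the valuation ring of `L` reduce to elements of degree dividing `[L : K]`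
over the residue field of `K`, when `[L : K]` is prime and the extension is unibranched. -/
theorem IsUnibranched.natDegree_minpoly_residue_dvd [FiniteDimensional K L]
    {v : AddValuation L (WithTop Γ)} (hU : IsUnibranched K v) (hp : (Module.finrank K L).Prime)
    [FiniteDimensional (ResidueField (valuationRing (restr K v))) (ResidueField (valuationRing v))] :
    ∀ x : valuationRing v,
    (minpoly (ResidueField (valuationRing (restr K v))) (residue (valuationRing v) x)).natDegree ∣
      Module.finrank K L := by
  set R := valuationRing (restr K v)
  set S := valuationRing v
  set k := ResidueField R
  intro x
  set xb := residue S x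
  set g := minpoly k xb
  have hint : IsIntegral R (x : L) := hU.isIntegral x.2
  have hintk : IsIntegral k xb := Algebra.IsIntegral.isIntegral _
  have hcomm : ∀ P : R[X], aeval xb (P.map (residue R)) = residue S (aeval x P) := by
    intro P
    rw [aeval_def, eval₂_map, aeval_def, hom_eval₂]
    congr 1
  by_cases hxK : (x : L) ∈ (algebraMap K L).range
  · obtain ⟨c, hc⟩ := hxK
    have hcR : c ∈ R := by
      rw [mem_valuationRing, restr_apply, hc]
      exact x.2
    have : xb = algebraMap k (ResidueField S) (residue R ⟨c, hcR⟩) := by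
      change residue S x = residue S (algebraMap R S ⟨c, hcR⟩)
      congr 1
      exact Subtype.ext hc.symm
    have hg1 : g.natDegree = 1 := by
      rw [minpoly.natDegree_eq_one_iff, this]
      exact ⟨_, rfl⟩
    rw [hg1]
    exact one_dvd _
  set f := minpoly R (x : L)
  have hfmonic : f.Monic := minpoly.monic hint
  have hfdeg : f.natDegree = Module.finrank K L := by
    have h1 : (minpoly K (x : L)).natDegree = f.natDegree := by
      rw [minpoly.isIntegrallyClosed_eq_field_fractions' K hint, hfmonic.natDegree_map]
    rw [← h1]
    have h2 := minpoly.degree_dvd (K := K) (Algebra.IsIntegral.isIntegral (R := K) (x : L))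
    refine ((Nat.dvd_prime hp).mp h2).resolve_left ?_
    intro h3
    exact hxK (minpoly.natDegree_eq_one_iff.mp h3)
  set fb := f.map (residue R)
  have hfb0 : fb ≠ 0 := (hfmonic.map _).ne_zero
  have hgfin : FiniteMultiplicity g fb := by
    apply FiniteMultiplicity.of_not_isUnit (minpoly.not_isUnit k xb) hfb0
  obtain ⟨h, hh, hgh⟩ := hgfin.exists_eq_pow_mul_and_not_dvd
  -- The reduction of `f` is a power of `g` up to a unit. If another irreducible `q` divided it, a
  -- lift `Q` would have `Q(x)` a unit of `S`. Its inverse `y` is integral, so `y ∈ R[y⁻¹] ⊆ R[x]`,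
  -- say `y = P(x)`. Then `f` divides `QP - 1`, and reduction makes `q` divide `1`.
  have hhu : IsUnit h := by
    by_contra hnu
    obtain ⟨q, hq, hqh⟩ := WfDvdMonoid.exists_irreducible_factor hnu (by
      rintro rfl
      exact hgh (dvd_zero _))
    have hqx : aeval xb q ≠ 0 := by
      intro h0
      have h1 : g ∣ q := minpoly.dvd k xb h0
      have h2 : Associated g q :=
        (minpoly.irreducible hintk).associated_of_dvd hq h1
      exact hgh (h2.dvd.trans hqh)
    obtain ⟨Q, rfl⟩ := map_surjective (residue R) residue_surjective q
    rw [hcomm, ne_eq, residue_eq_zero_iff] at hqx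
    have hu : IsUnit (aeval x Q) := by
      rw [mem_maximalIdeal, mem_nonunits_iff, not_not] at hqx
      exact hqx
    obtain ⟨y, hy⟩ := isUnit_iff_exists_inv.mp hu
    have hyL : aeval (x : L) Q * (y : L) = 1 := by
      have := congrArg (algebraMap S L) hy
      rw [map_mul, ← aeval_algebraMap_apply, map_one] at this
      exact this
    have hyi : IsIntegral R (y : L) := hU.isIntegral y.2
    have hyinv : (y : L)⁻¹ = aeval (x : L) Q := (eq_inv_of_mul_eq_one_left hyL).symm
    have hmem : (y : L) ∈ Algebra.adjoin R {(x : L)} := by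
      have h1 : (y : L) ∈ Algebra.adjoin R {(y : L)⁻¹} :=
        mem_adjoin_inv_of_isIntegral hyi
      have h2 : Algebra.adjoin R {(y : L)⁻¹} ≤ Algebra.adjoin R {(x : L)} := by
        rw [Algebra.adjoin_le_iff, Set.singleton_subset_iff, hyinv]
        exact aeval_mem_adjoin_singleton _ _
      exact h2 h1
    rw [Algebra.adjoin_singleton_eq_range_aeval] at hmem
    obtain ⟨P, hP⟩ := hmem
    have hdvd : f ∣ Q * P - 1 := by
      apply minpoly.isIntegrallyClosed_dvd hint
      rw [map_sub, map_mul, map_one]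
      erw [hP]
      rw [hyL, sub_self]
    have h3 : Q.map (residue R) ∣ Q.map (residue R) * P.map (residue R) - 1 := by
      have h4 := Polynomial.map_dvd (residue R) hdvd
      rw [Polynomial.map_sub, Polynomial.map_mul, Polynomial.map_one] at h4
      exact (hqh.trans (hh.symm ▸ dvd_mul_left _ _ : h ∣ fb)).trans h4
    rw [dvd_sub_right (dvd_mul_right _ _)] at h3
    exact hq.not_isUnit (isUnit_of_dvd_one h3)
  have hd : fb.natDegree = multiplicity g fb * g.natDegree := by
    conv_lhs => rw [hh]
    rw [natDegree_mul (pow_ne_zero _ (minpoly.ne_zero hintk)) hhu.ne_zero, natDegree_pow,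
      natDegree_eq_zero_of_isUnit hhu, add_zero]
  rw [hfmonic.natDegree_map, hfdeg] at hd
  exact Dvd.intro_left _ hd.symm

theorem index_bounds {v : AddValuation L (WithTop Γ)} (h : 1 < defect K v) :
    (ramificationIndex K v ≠ 0 ∧ ramificationIndex K v ≤ ramificationIndex K v * residueDegree K v) ∧
    (residueDegree K v ≠ 0 ∧ residueDegree K v ≤ ramificationIndex K v * residueDegree K v) ∧
    ramificationIndex K v * residueDegree K v < Module.finrank K L := by
  unfold defect at h
  have h0 : ramificationIndex K v * residueDegree K v ≠ 0 := by
    intro h0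
    have : ((ramificationIndex K v : ℚ) * residueDegree K v) = 0 := by exact_mod_cast h0
    rw [this, div_zero] at h
    exact absurd h (by norm_num)
  have hpos : (0 : ℚ) < (ramificationIndex K v : ℚ) * residueDegree K v := by
    exact_mod_cast Nat.pos_of_ne_zero h0
  rw [one_lt_div hpos] at h
  have he := left_ne_zero_of_mul h0
  have hf := right_ne_zero_of_mul h0
  exact ⟨⟨he, Nat.le_mul_of_pos_right _ (Nat.pos_of_ne_zero hf)⟩,
    ⟨hf, Nat.le_mul_of_pos_left _ (Nat.pos_of_ne_zero he)⟩, by exact_mod_cast h⟩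

theorem IsDefectExtension.valueGroup_eq {v : AddValuation L (WithTop Γ)}
    (hE : IsDefectExtension K v) (hp : (Module.finrank K L).Prime) :
    valueGroup v = valueGroup (restr K v) := by
  have := hE.finite
  obtain ⟨⟨he, he'⟩, -, hlt⟩ := index_bounds hE.one_lt_defect
  refine le_antisymm ?_ (valueGroup_restr_le v)
  rw [← AddSubgroup.addSubgroupOf_eq_top]
  apply eq_top_of_nsmul_mem hp _ he (he'.trans_lt hlt)
  intro x
  exact hE.unibranched.finrank_nsmul_mem x.2

theorem IsDefectExtension.exists_residue_eq {v : AddValuation L (WithTop Γ)}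
    (hE : IsDefectExtension K v) (hp : (Module.finrank K L).Prime) {x : L} (hx : 0 ≤ v x) :
    ∃ c : K, 0 < v (x - algebraMap K L c) := by
  have := hE.finite
  obtain ⟨-, ⟨hf, hf'⟩, hlt⟩ := index_bounds hE.one_lt_defect
  have hfin : FiniteDimensional (ResidueField (valuationRing (restr K v)))
      (ResidueField (valuationRing v)) :=
    FiniteDimensional.of_finrank_pos (Nat.pos_of_ne_zero hf)
  have hdvd := hE.unibranched.natDegree_minpoly_residue_dvd hp ⟨x, hx⟩
  have hle := minpoly.natDegree_le (A := ResidueField (valuationRing (restr K v)))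
    (residue (valuationRing v) ⟨x, hx⟩)
  -- The degree of the residue divides `p` and is at most `[Lv : Kv] < p`, so it is `1`.
  have h1 := ((Nat.dvd_prime hp).mp hdvd).resolve_right (hle.trans_lt (hf'.trans_lt hlt)).ne
  obtain ⟨c, hc⟩ := minpoly.natDegree_eq_one_iff.mp h1
  obtain ⟨c, rfl⟩ := residue_surjective c
  refine ⟨c, ?_⟩
  have h2 : residue (valuationRing v) (⟨x, hx⟩ -
      algebraMap (valuationRing (restr K v)) (valuationRing v) c) = 0 := by
    rw [map_sub, sub_eq_zero]
    exact hc.symm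
  rw [residue_eq_zero_iff] at h2
  have h3 := (Valuation.mem_maximalIdeal_iff (v := AddValuation.toValuation v)).mp h2
  exact h3

/-- Equality of value groups scales `x` to a unit, and equality of residue fields then supplies its
leading term in `K`. -/
theorem IsDefectExtension.exists_val_lt_val_sub {v : AddValuation L (WithTop Γ)}
    (hE : IsDefectExtension K v) (hp : (Module.finrank K L).Prime) {x : L} (hx : x ≠ 0) :
    ∃ c : K, v x < v (x - algebraMap K L c) := by
  obtain ⟨γ, hγ⟩ := exists_val v hx
  have hmem : γ ∈ valueGroup (restr K v) := hE.valueGroup_eq hp ▸ ⟨x, hγ⟩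
  obtain ⟨d, hd⟩ := hmem
  have hd0 : algebraMap K L d ≠ 0 := coe_ne_zero_of_val (v := v) hd
  have h0 : v (x / algebraMap K L d) = 0 := by
    rw [val_div hγ hd, sub_self]
    rfl
  obtain ⟨c, hc⟩ := hE.exists_residue_eq hp h0.ge
  refine ⟨c * d, ?_⟩
  have : x - algebraMap K L (c * d) = (x / algebraMap K L d - algebraMap K L c) *
      algebraMap K L d := by
    rw [map_mul, sub_mul, div_mul_cancel₀ _ hd0]
  rw [this, v.map_mul, ← restr_apply v d, hd, hγ]
  generalize v (x / algebraMap K L d - algebraMap K L c) = t at hc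
  induction t using WithTop.recTopCoe with
  | top => simp
  | coe t =>
    norm_cast at hc ⊢
    exact lt_add_of_pos_left γ hc

theorem IsDefectExtension.exists_val_sub_lt {v : AddValuation L (WithTop Γ)}
    (hE : IsDefectExtension K v) (hp : (Module.finrank K L).Prime) {x : L}
    (hx : x ∉ Set.range (algebraMap K L)) (c : K) :
    ∃ d : K, v (x - algebraMap K L c) < v (x - algebraMap K L d) := by
  obtain ⟨d, hd⟩ := hE.exists_val_lt_val_sub hp
    (show x - algebraMap K L c ≠ 0 from fun h ↦ hx ⟨c, (sub_eq_zero.mp h).symm⟩)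
  exact ⟨c + d, by rwa [map_add, ← sub_sub]⟩

end Valued

/-! ### Eventual comparison of affine functions along values without maximum. -/

section Slopes
variable {Γ : Type*} [LinearOrder Γ] {ι : Type*}

/-- The filter on the index type of a family of values generated by the final segments
`{d | g c ≤ g d}`. -/
def tailFilter (g : ι → Γ) : Filter ι := ⨅ c, 𝓟 {d | g c ≤ g d}

theorem eventually_tailFilter [Nonempty ι] {g : ι → Γ} {P : ι → Prop} :
    (∀ᶠ c in tailFilter g, P c) ↔ ∃ c, ∀ d, g c ≤ g d → P d := by
  have hdir : Directed (· ≥ ·) fun c ↦ {d | g c ≤ g d} := by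
    intro c c'
    rcases le_total (g c) (g c') with h | h
    · exact ⟨c', fun d hd ↦ h.trans hd, fun d hd ↦ hd⟩
    · exact ⟨c, fun d hd ↦ hd, fun d hd ↦ h.trans hd⟩
  rw [tailFilter, (hasBasis_iInf_principal hdir).eventually_iff]
  simp

theorem tailFilter_neBot [Nonempty ι] (g : ι → Γ) : (tailFilter g).NeBot := by
  rw [neBot_iff]
  intro h
  have h1 : ∀ᶠ _ in tailFilter g, False := by rw [h]; trivial
  obtain ⟨c, hc⟩ := eventually_tailFilter.mp h1
  exact hc c le_rfl

theorem eventually_lt_tail [Nonempty ι] {g : ι → Γ} (hg : ∀ c, ∃ d, g c < g d) (c : ι) :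
    ∀ᶠ d in tailFilter g, g c < g d := by
  obtain ⟨d, hd⟩ := hg c
  exact eventually_tailFilter.mpr ⟨d, fun e he ↦ hd.trans_le he⟩

variable [AddCommGroup Γ] [IsOrderedAddMonoid Γ]

/-- The difference of the two sides is strictly increasing in `g c`: either it is nonnegative
somewhere, hence positive further out, or it is negative throughout. Ties cannot persist because `g`
has no maximum. -/
theorem eventually_lt_or_aux [Nonempty ι] {g : ι → Γ} (hg : ∀ c, ∃ d, g c < g d) (α β : Γ)
    {i j : ℕ} (hij : i < j) :
    (∀ᶠ c in tailFilter g, α + i • g c < β + j • g c) ∨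
      (∀ᶠ c in tailFilter g, β + j • g c < α + i • g c) := by
  obtain ⟨n, rfl⟩ := Nat.exists_eq_add_of_lt hij
  have key : ∀ c, β + (i + n + 1) • g c = (β + (n + 1) • g c) + i • g c := by
    intro c
    rw [add_assoc i, add_nsmul, add_assoc, add_comm (i • g c)]
  by_cases h : ∃ c, α ≤ β + (n + 1) • g c
  · left
    obtain ⟨c, hc⟩ := h
    filter_upwards [eventually_lt_tail hg c] with d hd
    rw [key]
    refine add_lt_add_left (hc.trans_lt ?_) _
    exact add_lt_add_right (nsmul_lt_nsmul_right (Nat.succ_ne_zero n) hd) _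
  · right
    push Not at h
    filter_upwards with d
    rw [key]
    exact add_lt_add_left (h d) _

theorem eventually_lt_or [Nonempty ι] {g : ι → Γ} (hg : ∀ c, ∃ d, g c < g d) (α β : Γ)
    {i j : ℕ} (hij : i ≠ j) :
    (∀ᶠ c in tailFilter g, α + i • g c < β + j • g c) ∨
      (∀ᶠ c in tailFilter g, β + j • g c < α + i • g c) := by
  rcases hij.lt_or_gt with h | h
  · exact eventually_lt_or_aux hg α β h
  · exact (eventually_lt_or_aux hg β α h).symm

theorem slope_unique [Nonempty ι] {g : ι → Γ} (hg : ∀ c, ∃ d, g c < g d) {α β : Γ}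
    {i j : ℕ} (h : ∀ᶠ c in tailFilter g, α + i • g c = β + j • g c) : i = j := by
  by_contra hij
  have := tailFilter_neBot g
  rcases eventually_lt_or hg α β hij with h1 | h1 <;>
  · obtain ⟨c, hc, hc'⟩ := (h.and h1).exists
    exact absurd hc (by first | exact hc'.ne | exact hc'.ne')

theorem exists_dominant [Nonempty ι] {g : ι → Γ} (hg : ∀ c, ∃ d, g c < g d) (β : ℕ → Γ)
    {s : Finset ℕ} (hs : s.Nonempty) :
    ∃ j ∈ s, ∀ᶠ c in tailFilter g, ∀ i ∈ s, i ≠ j → β j + j • g c < β i + i • g c := by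
  induction hs using Finset.Nonempty.cons_induction with
  | singleton a => exact ⟨a, by simp, .of_forall fun c i hi hne ↦ absurd (by simpa using hi) hne⟩
  | cons a s ha hs ih =>
    obtain ⟨j, hj, hjs⟩ := ih
    have haj : a ≠ j := fun h ↦ ha (h ▸ hj)
    rcases eventually_lt_or hg (β a) (β j) haj with h | h
    · refine ⟨a, by simp, ?_⟩
      filter_upwards [hjs, h] with c h1 h2 i hi hia
      have his : i ∈ s := by simpa [hia] using hi
      by_cases hij : i = j
      · rwa [hij]
      · exact h2.trans (h1 i his hij)
    · refine ⟨j, by simp [hj], ?_⟩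
      filter_upwards [hjs, h] with c h1 h2 i hi hij
      by_cases hia : i = a
      · rwa [hia]
      · exact h1 i (by simpa [hia] using hi) hij

end Slopes

/-! ### Values of polynomials of degree less than `p` near `ϑ`. -/

section Valued
variable {Γ : Type*} [AddCommGroup Γ] [LinearOrder Γ] [IsOrderedAddMonoid Γ]
variable {K L : Type*} [Field K] [Field L] [Algebra K L]

theorem val_sum_eq_of_dominant (v : AddValuation L (WithTop Γ)) {s : Finset ℕ} {t : ℕ → L} {j : ℕ}
    (hj : j ∈ s) (h : ∀ i ∈ s, i ≠ j → v (t j) < v (t i)) : v (∑ i ∈ s, t i) = v (t j) := by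
  rw [← Finset.add_sum_erase s t hj]
  by_cases hs : (s.erase j).Nonempty
  · obtain ⟨i, hi⟩ := hs
    have hlt := h i (Finset.mem_of_mem_erase hi) (Finset.ne_of_mem_erase hi)
    apply v.map_add_eq_of_lt_left
    exact v.map_lt_sum' (lt_of_lt_of_le hlt le_top) fun i hi ↦
      h i (Finset.mem_of_mem_erase hi) (Finset.ne_of_mem_erase hi)
  · rw [Finset.not_nonempty_iff_eq_empty.mp hs, Finset.sum_empty, add_zero]

/-- If the `j`-th term of a polynomial dominates at all points of value `g c`, with `c` far out, then
it determines the value of the polynomial. -/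
theorem exists_val_eval_eq {ι : Type*} [Nonempty ι] (v : AddValuation L (WithTop Γ))
    {g : ι → Γ} (hg : ∀ c, ∃ d, g c < g d) {A : L[X]} (hA : A ≠ 0) :
    ∃ j ∈ A.support, ∀ᶠ c in tailFilter g,
      (∀ i ∈ A.support, i ≠ j → v (A.coeff j) + j • (g c : WithTop Γ) <
        v (A.coeff i) + i • (g c : WithTop Γ)) ∧
      ∀ y : L, v y = g c → v (A.eval y) = v (A.coeff j) + j • (g c : WithTop Γ) := by
  have hβ : ∀ i : ℕ, ∃ β : Γ, i ∈ A.support → v (A.coeff i) = β := by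
    intro i
    by_cases hi : i ∈ A.support
    · obtain ⟨β, hβ⟩ := exists_val v (mem_support_iff.mp hi)
      exact ⟨β, fun _ ↦ hβ⟩
    · exact ⟨0, fun h ↦ absurd h hi⟩
  choose β hβ using hβ
  obtain ⟨j, hj, hjs⟩ := exists_dominant hg β (support_nonempty.mpr hA)
  refine ⟨j, hj, ?_⟩
  filter_upwards [hjs] with c hc
  have h1 : ∀ i ∈ A.support, i ≠ j → v (A.coeff j) + j • (g c : WithTop Γ) <
        v (A.coeff i) + i • (g c : WithTop Γ) := by
    intro i hi hij
    rw [hβ j hj, hβ i hi]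
    exact_mod_cast hc i hi hij
  refine ⟨h1, fun y hy ↦ ?_⟩
  rw [eval_eq_sum, Polynomial.sum, val_sum_eq_of_dominant v hj]
  · rw [v.map_mul, v.map_pow, hy]
  · intro i hi hij
    simpa only [v.map_mul, v.map_pow, hy] using h1 i hi hij

variable {v : AddValuation L (WithTop Γ)} {ϑ : L} {g : K → Γ} {p : ℕ}

/-- Approximation of a polynomial of degree less than `p` near `ϑ` by its linear part, provided that
the value of its derivative is stationary near `ϑ`. -/
theorem eventually_val_aeval_sub (hg : ∀ c, v (ϑ - algebraMap K L c) = g c)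
    (hmax : ∀ c, ∃ d, g c < g d) (hres : ∀ i : ℕ, 0 < i → i < p → v (i : L) = 0)
    {f : K[X]} (hfp : f.natDegree < p) (hf0 : aeval ϑ (derivative f) ≠ 0)
    (hf : ∀ᶠ c in tailFilter g,
      v (aeval (algebraMap K L c) (derivative f)) = v (aeval ϑ (derivative f))) :
    ∀ᶠ c in tailFilter g, ∀ x : L, (g c : WithTop Γ) ≤ v (x - ϑ) →
      v (aeval x f - aeval ϑ f) = v (aeval ϑ (derivative f)) + v (x - ϑ) := by
  have := tailFilter_neBot g
  set F : L[X] := taylor ϑ (f.map (algebraMap K L)) with hF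
  set A : L[X] := derivative F
  have hAeval : ∀ y, A.eval y = aeval (y + ϑ) (derivative f) := by
    intro y
    rw [show A = taylor ϑ (derivative (f.map (algebraMap K L))) by
      simp only [A, hF, taylor_apply, derivative_comp, derivative_add, derivative_X, derivative_C,
        add_zero, one_mul],
      taylor_eval, derivative_map, eval_map_algebraMap]
  have hA0 : A.coeff 0 = aeval ϑ (derivative f) := by
    rw [coeff_zero_eq_eval_zero, hAeval, zero_add]
  have hA : A ≠ 0 := by
    rintro h
    rw [h, coeff_zero] at hA0
    exact hf0 hA0.symm
  obtain ⟨j, hj, hjs⟩ := exists_val_eval_eq v hmax hA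
  have h0 : 0 ∈ A.support := by
    rw [mem_support_iff, hA0]
    exact hf0
  have hval : ∀ c, v (algebraMap K L c - ϑ) = g c := fun c ↦ by rw [v.map_sub_swap, hg]
  -- A dominant term of positive index would have value strictly below that of the constant term
  -- `f'(ϑ)`, contrary to stationarity.
  have hj0 : j = 0 := by
    by_contra hj0
    obtain ⟨c, ⟨h1, h2⟩, h3⟩ := (hjs.and hf).exists
    have h4 := h2 _ (hval c)
    rw [hAeval, sub_add_cancel, h3] at h4
    have h5 := h1 0 h0 (Ne.symm hj0)
    rw [← h4, hA0, zero_smul, add_zero] at h5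
    exact lt_irrefl _ h5
  subst hj0
  -- Coefficient `i` of `F'` is `i + 1` times coefficient `i + 1` of `F`, and `i + 1 < p` has value
  -- `0`. Thus the dominance of the constant term passes from `F'` to `(F - F(0))/X`.
  have hcoeff : ∀ i, i ∈ F.divX.support → v (F.divX.coeff i) = v (A.coeff i) := by
    intro i hi
    rw [mem_support_iff, coeff_divX] at hi
    have hle : i + 1 ≤ F.natDegree := le_natDegree_of_ne_zero hi
    rw [hF, natDegree_taylor, natDegree_map] at hle
    rw [coeff_derivative, coeff_divX, v.map_mul]
    have := hres (i + 1) (Nat.succ_pos i) (by omega)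
    push_cast at this
    rw [this, add_zero]
  filter_upwards [hjs] with c hc x hx
  have hFx : aeval x f - aeval ϑ f = F.divX.eval (x - ϑ) * (x - ϑ) := by
    have h1 : F.eval (x - ϑ) = aeval x f := by
      rw [hF, taylor_eval, sub_add_cancel, eval_map_algebraMap]
    have h2 : F.coeff 0 = aeval ϑ f := by
      rw [hF, taylor_coeff_zero, eval_map_algebraMap]
    rw [← h1, ← h2]
    nth_rw 1 [← divX_mul_X_add F]
    simp
  have h0' : 0 ∈ F.divX.support := by
    rw [mem_support_iff, coeff_divX]
    intro h
    apply hf0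
    rw [← hA0, coeff_derivative, h, zero_mul]
  rw [hFx, v.map_mul, ← hA0, ← hcoeff 0 h0', eval_eq_sum, Polynomial.sum,
    val_sum_eq_of_dominant v h0', pow_zero, mul_one]
  intro i hi hi0
  rw [pow_zero, mul_one, hcoeff 0 h0', v.map_mul, v.map_pow, hcoeff i hi]
  have hiA : i ∈ A.support := by
    rw [mem_support_iff]
    intro h
    have := hcoeff i hi
    rw [h, v.map_zero, v.top_iff] at this
    exact (mem_support_iff.mp hi) this
  have h1 := hc.1 i hiA hi0
  rw [zero_smul, add_zero] at h1
  exact h1.trans_le (add_le_add_right (nsmul_le_nsmul_right hx i) _)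

/-- Expansion in powers of a polynomial `f` whose value grows linearly with slope one. -/
theorem exists_slope (hmax : ∀ c, ∃ d, g c < g d) {w : AddValuation K (WithTop Γ)} {f : K[X]}
    (hk : 0 < f.natDegree) {β : Γ}
    (hf : ∀ᶠ c in tailFilter g, w (f.eval c) = ((β + g c : Γ) : WithTop Γ))
    (hlow : ∀ r : K[X], r ≠ 0 → r.natDegree < f.natDegree →
      ∃ ρ : Γ, ∀ᶠ c in tailFilter g, w (r.eval c) = ρ) (q : K[X]) (hq : q ≠ 0) :
    ∃ (α : Γ) (j : ℕ), j * f.natDegree ≤ q.natDegree ∧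
      ∀ᶠ c in tailFilter g, w (q.eval c) = ((α + j • g c : Γ) : WithTop Γ) := by
  induction hn : q.natDegree using Nat.strong_induction_on generalizing q with
  | _ n ih =>
  subst hn
  by_cases hlt : q.natDegree < f.natDegree
  · obtain ⟨ρ, hρ⟩ := hlow q hq hlt
    refine ⟨ρ, 0, by simp, ?_⟩
    simpa using hρ
  push Not at hlt
  have hf0 : f ≠ 0 := by
    rintro rfl
    simp at hk
  have hdle : f.degree ≤ q.degree := by
    rw [degree_eq_natDegree hf0, degree_eq_natDegree hq]
    exact_mod_cast hlt
  have hq1 : q / f ≠ 0 := by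
    rwa [ne_eq, Polynomial.div_eq_zero_iff hf0, not_lt]
  have hdeg : f.natDegree + (q / f).natDegree = q.natDegree := by
    have := degree_add_div hf0 hdle
    rw [degree_eq_natDegree hf0, degree_eq_natDegree hq, degree_eq_natDegree hq1] at this
    exact_mod_cast this
  obtain ⟨α, j, hj, hα⟩ := ih _ (by omega) (q / f) hq1 rfl
  have hmul : ∀ᶠ c in tailFilter g,
      w ((f * (q / f)).eval c) = (((β + α) + (j + 1) • g c : Γ) : WithTop Γ) := by
    filter_upwards [hf, hα] with c h1 h2
    rw [eval_mul, w.map_mul, h1, h2, ← WithTop.coe_add, succ_nsmul]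
    congr 1
    abel
  have hdm := EuclideanDomain.div_add_mod q f
  have hj' : (j + 1) * f.natDegree ≤ q.natDegree := by
    rw [add_mul, one_mul]
    omega
  by_cases hr : q % f = 0
  · rw [hr, add_zero] at hdm
    rw [hdm] at hmul
    exact ⟨β + α, j + 1, hj', hmul⟩
  · have hrdeg : (q % f).natDegree < f.natDegree :=
      natDegree_mod_lt _ hk.ne'
    obtain ⟨ρ, hρ⟩ := hlow _ hr hrdeg
    -- The multiple of `f` has slope `j + 1` and the remainder slope `0`, so far out their values
    -- differ and the smaller one is the value of the sum.
    rcases eventually_lt_or hmax (β + α) ρ (Nat.succ_ne_zero j) with h | h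
    · refine ⟨β + α, j + 1, hj', ?_⟩
      filter_upwards [hmul, hρ, h] with c h1 h2 h3
      rw [← hdm, eval_add, w.map_add_eq_of_lt_left, h1]
      rw [h1, h2]
      simpa using WithTop.coe_lt_coe.mpr h3
    · refine ⟨ρ, 0, by simp, ?_⟩
      filter_upwards [hmul, hρ, h] with c h1 h2 h3
      rw [← hdm, eval_add, w.map_add_eq_of_lt_right, h2]
      · simp
      rw [h1, h2]
      simpa using WithTop.coe_lt_coe.mpr h3

theorem derivative_ne_zero_of_val (hres : ∀ i : ℕ, 0 < i → i < p → v (i : L) = 0) {f : K[X]}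
    (hk : 0 < f.natDegree) (hfp : f.natDegree < p) : derivative f ≠ 0 := by
  intro h0
  have h1 : (derivative f).coeff (f.natDegree - 1) = 0 := by rw [h0, coeff_zero]
  have h2 : (((f.natDegree - 1 : ℕ) : K) + 1) = (f.natDegree : K) := by
    rw [← Nat.cast_add_one, Nat.sub_add_cancel hk]
  rw [coeff_derivative, Nat.sub_add_cancel hk, h2] at h1
  rcases mul_eq_zero.mp h1 with h3 | h3
  · rw [coeff_natDegree, leadingCoeff_eq_zero] at h3
    rw [h3] at hk
    simp at hk
  · have h4 := hres f.natDegree hk hfp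
    rw [← map_natCast (algebraMap K L), h3, map_zero, v.map_zero] at h4
    exact WithTop.top_ne_zero h4

/-- The values of polynomials of degree less than `p` are stationary near `ϑ`. -/
theorem eventually_val_aeval_eq (hg : ∀ c, v (ϑ - algebraMap K L c) = g c)
    (hmax : ∀ c, ∃ d, g c < g d) (hres : ∀ i : ℕ, 0 < i → i < p → v (i : L) = 0)
    (halg : ∀ f : K[X], f ≠ 0 → f.natDegree < p → aeval ϑ f ≠ 0)
    {h : K[X]} (hh0 : h ≠ 0) (hhp : h.natDegree = p)
    (hh : ∀ c, v (aeval (algebraMap K L c) h) = ((p • g c : Γ) : WithTop Γ))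
    (f : K[X]) (hf0 : f ≠ 0) (hfp : f.natDegree < p) :
    ∀ᶠ c in tailFilter g, v (aeval (algebraMap K L c) f) = v (aeval ϑ f) := by
  have hp0 : 0 < p := by omega
  induction hn : f.natDegree using Nat.strong_induction_on generalizing f with
  | _ n ih =>
  subst hn
  rcases Nat.eq_zero_or_pos f.natDegree with hk | hk
  · rw [eq_C_of_natDegree_eq_zero hk]
    simp
  have hd0 := derivative_ne_zero_of_val hres hk hfp
  have hdlt : (derivative f).natDegree < f.natDegree := natDegree_derivative_lt hk.ne'
  have hdfix := ih _ hdlt (derivative f) hd0 (hdlt.trans hfp) rfl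
  have hdϑ := halg _ hd0 (hdlt.trans hfp)
  have hlin := eventually_val_aeval_sub hg hmax hres hfp hdϑ hdfix
  obtain ⟨β, hβ⟩ := exists_val v hdϑ
  have hlin' : ∀ᶠ c in tailFilter g,
      v (aeval (algebraMap K L c) f - aeval ϑ f) = ((β + g c : Γ) : WithTop Γ) := by
    filter_upwards [hlin] with c hc
    have h1 : v (algebraMap K L c - ϑ) = g c := by rw [v.map_sub_swap, hg]
    rw [hc _ h1.ge, h1, hβ, WithTop.coe_add]
  by_cases hc0 : ∃ c, v (aeval ϑ f) ≤ ((β + g c : Γ) : WithTop Γ)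
  · obtain ⟨c0, hc0⟩ := hc0
    filter_upwards [hlin', eventually_lt_tail hmax c0] with c h1 h2
    apply v.map_eq_of_lt_sub
    rw [h1]
    refine hc0.trans_lt ?_
    exact WithTop.coe_lt_coe.mpr (add_lt_add_right h2 _)
  -- Otherwise `v(f(c))` itself grows with slope one. Expanding `h` in powers of `f` bounds its
  -- slope by `deg h / deg f`; that slope is `p = deg h`, so `f` is linear. But a linear `f` has its
  -- root `c` in `K`, and then `v(f(ϑ)) = β + g c`, contradicting `hc0`.
  exfalso
  push Not at hc0
  have hunf : ∀ᶠ c in tailFilter g,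
      restr K v (f.eval c) = ((β + g c : Γ) : WithTop Γ) := by
    filter_upwards [hlin'] with c h1
    rw [restr_apply, ← aeval_algebraMap_apply_eq_algebraMap_eval, ← h1]
    have h2 : v (aeval (algebraMap K L c) f - aeval ϑ f) < v (aeval ϑ f) := by
      rw [h1]
      exact hc0 c
    have h3 := v.map_add_eq_of_lt_left h2
    rwa [sub_add_cancel] at h3
  obtain ⟨α, j, hj, hα⟩ := exists_slope hmax hk hunf (by
    intro r hr hrd
    obtain ⟨ρ, hρ⟩ := exists_val v (halg r hr (hrd.trans hfp))
    refine ⟨ρ, ?_⟩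
    filter_upwards [ih _ hrd r hr (hrd.trans hfp) rfl] with c hc
    rw [restr_apply, ← aeval_algebraMap_apply_eq_algebraMap_eval, hc, hρ]) h hh0
  have hjp : p = j := by
    apply slope_unique hmax (α := 0) (β := α)
    filter_upwards [hα] with c hc
    rw [restr_apply, ← aeval_algebraMap_apply_eq_algebraMap_eval, hh] at hc
    rw [zero_add]
    exact WithTop.coe_inj.mp hc
  subst hjp
  have hk1 : f.natDegree = 1 := by
    rw [hhp] at hj
    have := Nat.le_of_mul_le_mul_left (hj.trans (mul_one p).ge) hp0
    omega
  have hlc : f.coeff 1 ≠ 0 := by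
    rw [← hk1]
    exact leadingCoeff_ne_zero.mpr hf0
  have hlc' : algebraMap K L (f.coeff 1) ≠ 0 := (_root_.map_ne_zero _).mpr hlc
  have hfeq := eq_X_add_C_of_natDegree_le_one hk1.le
  have h1 : aeval ϑ f = algebraMap K L (f.coeff 1) *
      (ϑ - algebraMap K L (-(f.coeff 0) / f.coeff 1)) := by
    conv_lhs => rw [hfeq]
    simp only [map_add, map_mul, aeval_C, aeval_X, map_div₀, map_neg]
    field_simp
    ring
  have h2 := hc0 (-(f.coeff 0) / f.coeff 1)
  have h3 : aeval ϑ (derivative f) = algebraMap K L (f.coeff 1) := by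
    conv_lhs => rw [hfeq]
    simp
  rw [h1, v.map_mul, ← h3, hβ, hg, ← WithTop.coe_add] at h2
  exact lt_irrefl _ h2

end Valued

/-! ### Strongly convex subgroups and final segments of positive elements. -/

section OrderedGroup
variable {G : Type*} [AddCommGroup G] [LinearOrder G]

theorem above_pos {H : AddSubgroup G} {α : G} (h : α ∈ above H) : 0 < α := h 0 H.zero_mem

theorem above_of_le {H : AddSubgroup G} {α β : G} (h : α ∈ above H) (hle : α ≤ β) :
    β ∈ above H := fun γ hγ ↦ (h γ hγ).trans_le hle

variable [IsOrderedAddMonoid G]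

theorem nsmul_mem_above_iff {H : AddSubgroup G} {n : ℕ} (hn : n ≠ 0) {α : G} :
    n • α ∈ above H ↔ α ∈ above H := by
  constructor
  · intro h β hβ
    by_contra! hle
    exact absurd (h _ (H.nsmul_mem hβ n)) (not_lt.mpr (nsmul_le_nsmul_right hle n))
  · intro h
    exact above_of_le h (le_self_nsmul (above_pos h).le hn)

/-- Positive elements of `G/H` can be halved repeatedly: split `β` as `γ + (β - γ)` with both parts
above `H` and keep the smaller. No divisibility of `G` is needed. -/
theorem IsStronglyConvex.exists_nsmul_le {H : AddSubgroup G} (hH : IsStronglyConvex H) {α : G}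
    (hα : α ∈ above H) (n : ℕ) : ∃ β ∈ above H, n • β ≤ α := by
  have key : ∀ k : ℕ, ∃ β ∈ above H, 2 ^ k • β ≤ α := by
    intro k
    induction k with
    | zero => exact ⟨α, hα, by simp⟩
    | succ k ih =>
      obtain ⟨β, hβ, hle⟩ := ih
      obtain ⟨γ, hγ, hγ'⟩ := hH.no_least_pos β hβ
      have h2 : ∀ x y : G, x ≤ y → 2 ^ (k + 1) • x ≤ 2 ^ k • (y + x) := by
        intro x y hxy
        rw [pow_succ, mul_nsmul, two_nsmul, nsmul_add]
        exact add_le_add_left (nsmul_le_nsmul_right hxy _) _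
      rcases le_total γ (β - γ) with h | h
      · exact ⟨γ, hγ, (h2 _ _ h).trans (by rwa [sub_add_cancel])⟩
      · exact ⟨β - γ, hγ', (h2 _ _ h).trans (by rwa [add_sub_cancel])⟩
  obtain ⟨β, hβ, hle⟩ := key n
  exact ⟨β, hβ, (nsmul_le_nsmul_left (above_pos hβ).le Nat.lt_two_pow_self.le).trans hle⟩

variable {p : ℕ} {A : Set G}

theorem image_nsmul_eq_aboveMul_iff (hp : p ≠ 0) {H : AddSubgroup G} :
    mulSet p A = aboveMul p H ↔ A = above H := by
  have h : aboveMul p H = mulSet p (above H) := by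
    ext α
    constructor
    · rintro ⟨⟨β, rfl⟩, hβ⟩
      exact ⟨β, (nsmul_mem_above_iff hp).mp hβ, rfl⟩
    · rintro ⟨β, hβ, rfl⟩
      exact ⟨⟨β, rfl⟩, (nsmul_mem_above_iff hp).mpr hβ⟩
  rw [h]
  exact (Set.image_injective.mpr (nsmul_right_injective hp)).eq_iff

/-- This is the passage to condition d). The factor `p` is harmless because `{α > H}` contains
arbitrarily fine fractions of its elements. -/
theorem eq_above_iff_coinitial (hp : p ≠ 0) (hup : ∀ α ∈ A, ∀ β, α ≤ β → β ∈ A)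
    {H : AddSubgroup G} (hH : IsStronglyConvex H) :
    A = above H ↔ A ⊆ above H ∧ ∀ β ∈ above H, ∃ α ∈ A, p • α ≤ β := by
  constructor
  · rintro rfl
    exact ⟨subset_rfl, fun β hβ ↦ hH.exists_nsmul_le hβ p⟩
  · rintro ⟨h1, h2⟩
    refine h1.antisymm fun β hβ ↦ ?_
    obtain ⟨α, hα, hle⟩ := h2 β hβ
    exact hup α hα β ((le_self_nsmul (above_pos (h1 hα)).le hp).trans hle)

theorem exists_eq_above_iff_mulSet_eq (hp : 2 ≤ p) (hdiv : IsPDivisible p G) (hne : A.Nonempty)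
    (hpos : ∀ α ∈ A, 0 < α) (hup : ∀ α ∈ A, ∀ β, α ≤ β → β ∈ A) :
    (∃ H : AddSubgroup G, IsStronglyConvex H ∧ A = above H) ↔ mulSet p A = A := by
  have hp0 : p ≠ 0 := by omega
  constructor
  · rintro ⟨H, -, rfl⟩
    ext α
    constructor
    · rintro ⟨β, hβ, rfl⟩
      exact (nsmul_mem_above_iff hp0).mpr hβ
    · intro hα
      obtain ⟨β, rfl⟩ := hdiv α
      exact ⟨β, (nsmul_mem_above_iff hp0).mp hα, rfl⟩
  · intro hA
    -- An element of `A = pA` is `p • β ≥ 2 • β` with `β ∈ A`. This halving makes the set of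
    -- elements smaller in absolute value than all of `A` a subgroup, and it also excludes a least
    -- positive element of the quotient.
    have hhalf : ∀ α ∈ A, ∃ β ∈ A, β + β ≤ α := by
      intro α hα
      rw [← hA] at hα
      obtain ⟨β, hβ, rfl⟩ := hα
      refine ⟨β, hβ, ?_⟩
      rw [← two_nsmul]
      exact nsmul_le_nsmul_left (hpos β hβ).le hp
    let H : AddSubgroup G :=
      { carrier := {x | ∀ α ∈ A, |x| < α}
        zero_mem' := fun α hα ↦ by rw [abs_zero]; exact hpos α hα
        add_mem' := by
          intro x y hx hy α hα
          obtain ⟨β, hβ, hle⟩ := hhalf α hα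
          exact (abs_add_le x y).trans_lt ((add_lt_add (hx β hβ) (hy β hβ)).trans_le hle)
        neg_mem' := by
          intro x hx α hα
          rw [abs_neg]
          exact hx α hα }
    have hH : ∀ x, x ∈ H ↔ ∀ α ∈ A, |x| < α := fun x ↦ Iff.rfl
    have hAH : A = above H := by
      ext α
      constructor
      · intro hα β hβ
        exact (le_abs_self β).trans_lt ((hH β).mp hβ α hα)
      · intro hα
        have h1 : α ∉ H := fun h ↦ lt_irrefl _ (hα α h)
        rw [hH] at h1
        push Not at h1
        obtain ⟨β, hβ, hle⟩ := h1
        rw [abs_of_pos (above_pos hα)] at hle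
        exact hup β hβ α hle
    refine ⟨H, ⟨?_, ?_, ?_⟩, hAH⟩
    · intro htop
      obtain ⟨α, hα⟩ := hne
      have : α ∈ H := htop ▸ AddSubgroup.mem_top α
      exact absurd ((hH α).mp this α hα) (not_lt.mpr (le_abs_self α))
    · refine ⟨fun x hx y hy z hz α hα ↦ ?_⟩
      rw [abs_lt]
      exact ⟨(abs_lt.mp (hx α hα)).1.trans_le hz.1, hz.2.trans_lt (abs_lt.mp (hy α hα)).2⟩
    · rw [← hAH]
      intro α hα
      obtain ⟨β, hβ, hle⟩ := hhalf α hα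
      exact ⟨β, hβ, hup β hβ _ (le_sub_iff_add_le.mpr hle)⟩

theorem IsStronglyConvex.eq_bot (hr : IsRankOne G) {H : AddSubgroup G} (hH : IsStronglyConvex H) :
    H = ⊥ := by
  have := hr.2
  rw [AddSubgroup.eq_bot_iff_forall]
  intro x hx
  by_contra hx0
  apply hH.proper
  rw [eq_top_iff]
  intro y _
  have hax : |x| ∈ H := by
    rcases abs_choice x with h | h <;> rw [h]
    · exact hx
    · exact H.neg_mem hx
  obtain ⟨n, hn⟩ := Archimedean.arch |y| (abs_pos.mpr hx0)
  have h1 := H.nsmul_mem hax n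
  exact hH.convex.out (H.neg_mem h1) h1 (abs_le.mp hn)

theorem mem_above_bot {α : G} : α ∈ above (⊥ : AddSubgroup G) ↔ 0 < α := by
  constructor
  · exact above_pos
  · intro h β hβ
    rwa [(AddSubgroup.mem_bot.mp hβ)]

/-- Condition g) itself forces the value group to be dense, which is what strong convexity of the
trivial subgroup demands. -/
theorem isStronglyConvex_bot [Nontrivial G] (hp : 2 ≤ p) (hpos : ∀ α ∈ A, 0 < α)
    (h : ∀ β : G, 0 < β → ∃ α ∈ A, p • α ≤ β) : IsStronglyConvex (⊥ : AddSubgroup G) := by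
  refine ⟨bot_ne_top, ?_, ?_⟩
  · rw [AddSubgroup.coe_bot]
    exact Set.ordConnected_singleton
  · intro β hβ
    obtain ⟨α, hα, hle⟩ := h β (above_pos hβ)
    refine ⟨α, mem_above_bot.mpr (hpos α hα), mem_above_bot.mpr ?_⟩
    have h1 : α + α ≤ β := by
      rw [← two_nsmul]
      exact (nsmul_le_nsmul_left (hpos α hα).le hp).trans hle
    rw [sub_pos]
    exact (lt_add_of_pos_left α (hpos α hα)).trans_le h1

theorem rankOne_tfae (hr : IsRankOne G) (hp : 2 ≤ p) (hpos : ∀ α ∈ A, 0 < α)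
    (hup : ∀ α ∈ A, ∀ β, α ≤ β → β ∈ A) :
    [∃ H : AddSubgroup G, IsStronglyConvex H ∧ A = above H,
      ∃ H : AddSubgroup G, IsStronglyConvex H ∧ ∀ β ∈ above H, ∃ α ∈ A, p • α ≤ β,
      ∀ β : G, 0 < β → ∃ α ∈ A, p • α ≤ β].TFAE := by
  have := hr.1
  have hp0 : p ≠ 0 := by omega
  tfae_have 1 → 2 := by
    rintro ⟨H, hH, h⟩
    exact ⟨H, hH, ((eq_above_iff_coinitial hp0 hup hH).mp h).2⟩
  tfae_have 2 → 3 := by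
    rintro ⟨H, hH, h⟩ β hβ
    rw [hH.eq_bot hr] at h
    exact h β (mem_above_bot.mpr hβ)
  tfae_have 3 → 1 := by
    intro h
    have hH := isStronglyConvex_bot hp hpos h
    refine ⟨⊥, hH, (eq_above_iff_coinitial hp0 hup hH).mpr ⟨fun α hα ↦ ?_, fun β hβ ↦ ?_⟩⟩
    · exact mem_above_bot.mpr (hpos α hα)
    · exact h β (above_pos hβ)
  tfae_finish

end OrderedGroup

/-! ### The set `Σ_σ` in terms of `v(ϑ - K)`. -/

section Valued
variable {Γ : Type*} [AddCommGroup Γ] [LinearOrder Γ] [IsOrderedAddMonoid Γ]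
variable {K L : Type*} [Field K] [Field L] [Algebra K L]

theorem natDegree_minpoly_of_adjoin_eq_top [FiniteDimensional K L] {ϑ : L} (hϑ : K⟮ϑ⟯ = ⊤) :
    (minpoly K ϑ).natDegree = Module.finrank K L := by
  rw [← IntermediateField.adjoin.finrank (Algebra.IsIntegral.isIntegral ϑ), hϑ,
    IntermediateField.finrank_top']

theorem exists_aeval_eq_of_adjoin_eq_top [FiniteDimensional K L] {ϑ : L} (hϑ : K⟮ϑ⟯ = ⊤) (b : L) :
    ∃ f : K[X], f.natDegree < Module.finrank K L ∧ aeval ϑ f = b := by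
  have hint : IsIntegral K ϑ := Algebra.IsIntegral.isIntegral ϑ
  have hb : b ∈ K⟮ϑ⟯.toSubalgebra := by
    rw [hϑ]
    trivial
  rw [IntermediateField.adjoin_simple_toSubalgebra_of_isAlgebraic hint.isAlgebraic,
    Algebra.adjoin_singleton_eq_range_aeval] at hb
  obtain ⟨f, hf⟩ := hb
  refine ⟨f %ₘ minpoly K ϑ, ?_, ?_⟩
  · rw [← natDegree_minpoly_of_adjoin_eq_top hϑ]
    exact natDegree_modByMonic_lt _ (minpoly.monic hint) (minpoly.ne_one K ϑ)
  · rw [aeval_modByMonic_eq_self_of_root (minpoly.aeval K ϑ)]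
    exact hf

variable {v : AddValuation L (WithTop Γ)} {ϑ : L} {g : K → Γ} {p : ℕ}

/-- Lower bound for `v (σ b - b) - v b` in terms of a generator `ϑ`. -/
theorem exists_val_add_le [FiniteDimensional K L] (hdeg : Module.finrank K L = p)
    (hϑ : K⟮ϑ⟯ = ⊤) (hg : ∀ c, v (ϑ - algebraMap K L c) = g c)
    (hmax : ∀ c, ∃ d, g c < g d) (hres : ∀ i : ℕ, 0 < i → i < p → v (i : L) = 0)
    {h : K[X]} (hhp : h.natDegree = p)
    (hh : ∀ c, v (aeval (algebraMap K L c) h) = ((p • g c : Γ) : WithTop Γ))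
    (σ : L ≃ₐ[K] L) (hσ : ∀ c, (g c : WithTop Γ) ≤ v (σ ϑ - ϑ)) {b : L} (hb : σ b ≠ b) :
    ∃ c, v b + v (σ ϑ - ϑ) ≤ v (σ b - b) + (g c : WithTop Γ) := by
  have := tailFilter_neBot g
  have hp0 : 0 < p := hdeg ▸ Module.finrank_pos
  have hh0 : h ≠ 0 := by
    rintro rfl
    rw [natDegree_zero] at hhp
    omega
  have halg : ∀ f : K[X], f ≠ 0 → f.natDegree < p → aeval ϑ f ≠ 0 := by
    intro f hf hfp h0
    have h1 := natDegree_le_of_dvd (minpoly.dvd K ϑ h0) hf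
    rw [natDegree_minpoly_of_adjoin_eq_top hϑ, hdeg] at h1
    omega
  obtain ⟨f, hfp, rfl⟩ := exists_aeval_eq_of_adjoin_eq_top hϑ b
  rw [hdeg] at hfp
  have hk : f.natDegree ≠ 0 := by
    intro hk
    rw [eq_C_of_natDegree_eq_zero hk, aeval_C, AlgEquiv.commutes] at hb
    exact hb rfl
  have hf0 : f ≠ 0 := by
    rintro rfl
    exact hk natDegree_zero
  have hfix := eventually_val_aeval_eq hg hmax hres halg hh0 hhp hh
  have hdlt := natDegree_derivative_lt hk
  have hd0 := derivative_ne_zero_of_val hres (Nat.pos_of_ne_zero hk) hfp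
  have hdϑ := halg _ hd0 (hdlt.trans hfp)
  have hlin := eventually_val_aeval_sub hg hmax hres hfp hdϑ (hfix _ hd0 (hdlt.trans hfp))
  obtain ⟨c, h1, h2⟩ := (hlin.and (hfix f hf0 hfp)).exists
  refine ⟨c, ?_⟩
  -- The linear approximation is valid at `σ ϑ` too, since `σ ϑ` is at least as close to `ϑ` as `c`
  -- is.
  have h3 := h1 _ (hσ c)
  have h4 : v (algebraMap K L c - ϑ) = g c := by rw [v.map_sub_swap, hg]
  have h5 := h1 _ h4.ge
  rw [aeval_algEquiv, AlgHom.comp_apply] at h3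
  -- Since `f(c)` and `f(ϑ)` have the same value, their difference has at least that value.
  have h6 : v (aeval ϑ f) ≤ v (aeval ϑ (derivative f)) + (g c : WithTop Γ) := by
    rw [← h4, ← h5]
    exact v.map_le_sub h2.ge le_rfl
  have h3' : v (σ (aeval ϑ f) - aeval ϑ f) = v (aeval ϑ (derivative f)) + v (σ ϑ - ϑ) := h3
  rw [h3', add_right_comm]
  exact add_le_add_left h6 _

theorem mem_sigmaSet_iff [FiniteDimensional K L] (hdeg : Module.finrank K L = p)
    (hϑ : K⟮ϑ⟯ = ⊤) (hg : ∀ c, v (ϑ - algebraMap K L c) = g c)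
    (hmax : ∀ c, ∃ d, g c < g d) (hres : ∀ i : ℕ, 0 < i → i < p → v (i : L) = 0)
    (hlow : ∀ c, ∀ γ ∈ valueGroup v, γ ≤ g c → ∃ d, g d = γ)
    {h : K[X]} (hhp : h.natDegree = p)
    (hh : ∀ c, v (aeval (algebraMap K L c) h) = ((p • g c : Γ) : WithTop Γ))
    (σ : L ≃ₐ[K] L) {ε : Γ} (hε : v (σ ϑ - ϑ) = ε) (hσ : ∀ c, g c ≤ ε) (γ : valueGroup v) :
    γ ∈ sigmaSet v σ ↔ ∃ c, g c = ε - γ := by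
  constructor
  · rintro ⟨b, hb0, hb⟩
    have hσb : σ b ≠ b := by
      intro h0
      rw [h0, sub_self, zero_div, v.map_zero] at hb
      exact WithTop.top_ne_coe hb
    obtain ⟨c, hc⟩ := exists_val_add_le hdeg hϑ hg hmax hres hhp hh σ
      (fun c ↦ by rw [hε]; exact WithTop.coe_le_coe.mpr (hσ c)) hσb
    obtain ⟨β, hβ⟩ := exists_val v hb0
    obtain ⟨α, hα⟩ := exists_val v (sub_ne_zero.mpr hσb)
    rw [val_div hα hβ, WithTop.coe_inj] at hb
    rw [hβ, hα, hε, ← WithTop.coe_add, ← WithTop.coe_add, WithTop.coe_le_coe] at hc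
    apply hlow c
    · exact AddSubgroup.sub_mem _ ⟨_, hε⟩ γ.2
    · rw [← hb, sub_le_iff_le_add]
      have : g c + (α - β) = (α + g c) - β := by abel
      rw [this, le_sub_iff_add_le, add_comm]
      exact hc
  · rintro ⟨c, hc⟩
    refine ⟨ϑ - algebraMap K L c, coe_ne_zero_of_val (hg c), ?_⟩
    rw [map_sub, AlgEquiv.commutes, sub_sub_sub_cancel_right, val_div hε (hg c), hc, sub_sub_cancel]

end Valued

/-! ### Translates and multiples of sets of values. -/

section SetsOfValues
variable {Γ : Type*} [AddCommGroup Γ]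

theorem addSet_zero {M : Type*} [AddZeroClass M] (S : Set M) : addSet 0 S = S := by
  simp [addSet]

theorem toValues_injective {G : AddSubgroup Γ} :
    Function.Injective (toValues : Set G → Set (WithTop Γ)) :=
  Set.image_injective.mpr fun _ _ h ↦ Subtype.ext (WithTop.coe_inj.mp h)

theorem addSet_neg_injective {G : Type*} [AddCommGroup G] (δ : G) :
    Function.Injective fun S : Set G ↦ addSet δ (-S) := by
  intro S T h
  exact neg_injective (Set.image_injective.mpr (add_right_injective δ) h)

theorem mulSet_toValues {G : AddSubgroup Γ} (p : ℕ) (δ : G) (S : Set G) :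
    mulSet p (toValues (addSet δ (-S))) = toValues (addSet (p • δ) (-mulSet p S)) := by
  simp only [mulSet, toValues, addSet, ← Set.image_neg_eq_neg, Set.image_image]
  apply Set.image_congr
  intro α _
  rw [← WithTop.coe_nsmul]
  congr 1
  simp

theorem addSet_toValues {G : AddSubgroup Γ} (γ δ : G) (S : Set G) :
    addSet ((γ : Γ) : WithTop Γ) (toValues (addSet δ (-S))) = toValues (addSet (γ + δ) (-S)) := by
  simp only [toValues, addSet, ← Set.image_neg_eq_neg, Set.image_image]
  apply Set.image_congr
  intro α _
  rw [← WithTop.coe_add]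
  congr 1
  simp [add_assoc]

end SetsOfValues

/-! ### Reduction of the equivalent conditions to the final segment `distSet`. -/

section Valued
variable {Γ : Type*} [AddCommGroup Γ] [LinearOrder Γ] [IsOrderedAddMonoid Γ]
variable {K L : Type*} [Field K] [Field L] [Algebra K L]

/-- The set of all `α ∈ G` with `δ - α ∈ v(ϑ - K)`. -/
def distSet (K : Type*) {L : Type*} [Field K] [Field L] [Algebra K L]
    (v : AddValuation L (WithTop Γ)) (ϑ : L) (δ : Γ) (G : AddSubgroup Γ) : Set G :=
  {α | ∃ c : K, v (ϑ - algebraMap K L c) = ((δ - α : Γ) : WithTop Γ)}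

variable {v : AddValuation L (WithTop Γ)} {ϑ : L} {p : ℕ}
  {δ : valueGroup (restr K v)}

theorem exists_val_sub_eq (hG : valueGroup v = valueGroup (restr K v))
    (hϑ : ∀ c, ϑ ≠ algebraMap K L c) (δ : valueGroup (restr K v)) (c : K) :
    ∃ α ∈ distSet K v ϑ δ (valueGroup (restr K v)),
      v (ϑ - algebraMap K L c) = ((δ - α : Γ) : WithTop Γ) := by
  obtain ⟨γ, hγ⟩ := exists_val v (sub_ne_zero.mpr (hϑ c))
  have hmem : γ ∈ valueGroup (restr K v) := hG ▸ ⟨_, hγ⟩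
  have h : v (ϑ - algebraMap K L c) = ((δ - (δ - ⟨γ, hmem⟩ : valueGroup (restr K v)) : Γ) :
      WithTop Γ) := by
    rw [hγ]
    congr 1
    simp
  exact ⟨δ - ⟨γ, hmem⟩, ⟨c, h⟩, h⟩

theorem valSet_eq_toValues (hG : valueGroup v = valueGroup (restr K v))
    (hϑ : ∀ c, ϑ ≠ algebraMap K L c) (δ : valueGroup (restr K v)) :
    valSet v ϑ (Set.range (algebraMap K L)) =
      toValues (addSet δ (-distSet K v ϑ δ (valueGroup (restr K v)))) := by
  ext x
  simp only [valSet, toValues, addSet, ← Set.image_neg_eq_neg, Set.image_image, Set.mem_image,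
    Set.mem_range, exists_exists_eq_and]
  constructor
  · rintro ⟨c, rfl⟩
    obtain ⟨α, hα, h⟩ := exists_val_sub_eq hG hϑ δ c
    refine ⟨α, hα, ?_⟩
    rw [h]
    simp [sub_eq_add_neg]
  · rintro ⟨α, ⟨c, hc⟩, rfl⟩
    refine ⟨c, ?_⟩
    rw [hc]
    simp [sub_eq_add_neg]

theorem distSet_pos (hlt : ∀ c : K, v (ϑ - algebraMap K L c) < ((δ : Γ) : WithTop Γ)) :
    ∀ α ∈ distSet K v ϑ δ (valueGroup (restr K v)), 0 < α := by
  rintro α ⟨c, hc⟩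
  have := hlt c
  rw [hc, WithTop.coe_lt_coe, sub_lt_self_iff] at this
  exact this

/-- The set `v(ϑ - K) ∩ vK` is an initial segment of `vK`. -/
theorem exists_val_sub_eq_of_le {c : K} {γ : Γ} (hγ : γ ∈ valueGroup (restr K v))
    (h : (γ : WithTop Γ) ≤ v (ϑ - algebraMap K L c)) :
    ∃ d : K, v (ϑ - algebraMap K L d) = γ := by
  rcases h.eq_or_lt with h | h
  · exact ⟨c, h.symm⟩
  · obtain ⟨d, hd⟩ := hγ
    rw [restr_apply] at hd
    refine ⟨c + d, ?_⟩
    rw [map_add, ← sub_sub, v.map_sub_swap, v.map_sub_eq_of_lt_left, hd]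
    rwa [hd]

theorem distSet_upward : ∀ α ∈ distSet K v ϑ δ (valueGroup (restr K v)), ∀ β, α ≤ β →
    β ∈ distSet K v ϑ δ (valueGroup (restr K v)) := by
  rintro α ⟨c, hc⟩ β hle
  apply exists_val_sub_eq_of_le (AddSubgroup.sub_mem _ δ.2 β.2) (c := c)
  rw [hc]
  exact WithTop.coe_le_coe.mpr (sub_le_sub_left hle _)

/-- A nontrivial automorphism is required: without one the condition on all `σ ≠ 1` would be
vacuous. -/
theorem hasIndependentDefect_iff (hG : valueGroup v = valueGroup (restr K v))
    (hne : ∃ σ : L ≃ₐ[K] L, σ ≠ 1)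
    (hσ : ∀ σ : L ≃ₐ[K] L, σ ≠ 1 → sigmaSet v σ = distSet K v ϑ δ (valueGroup v)) :
    HasIndependentDefect K v ↔ ∃ H : AddSubgroup (valueGroup (restr K v)),
      IsStronglyConvex H ∧ distSet K v ϑ δ (valueGroup (restr K v)) = above H := by
  have h1 : HasIndependentDefect K v ↔ ∃ H : AddSubgroup (valueGroup v),
      IsStronglyConvex H ∧ distSet K v ϑ δ (valueGroup v) = above H := by
    refine exists_congr fun H ↦ and_congr_right fun _ ↦ ⟨fun h ↦ ?_, fun h σ hσ1 ↦ ?_⟩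
    · obtain ⟨σ, hσ1⟩ := hne
      rw [← hσ σ hσ1, h σ hσ1]
    · rw [hσ σ hσ1, h]
  rw [h1, hG]

variable {a : K} {F : K → K}

theorem valSet_eq_mulSet
    (hF : ∀ c, restr K v (a - F c) = p • v (ϑ - algebraMap K L c)) :
    valSet (restr K v) a (Set.range F) =
      mulSet p (valSet v ϑ (Set.range (algebraMap K L))) := by
  simp only [valSet, mulSet, ← Set.range_comp]
  congr 1
  ext c
  exact hF c

/-- With `v(ϑ - c) = δ - α` one has `v(a - F c) = p δ - p α`, so the inequality says `p α ≤ vb`.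
Adding `vb` on the right, rather than subtracting it on the left, also covers `b = 0`, where any `c`
works. -/
theorem forall_coinitial_iff (hG : valueGroup v = valueGroup (restr K v))
    (hϑ : ∀ c, ϑ ≠ algebraMap K L c)
    (hF : ∀ c, restr K v (a - F c) = p • v (ϑ - algebraMap K L c))
    (H : AddSubgroup (valueGroup (restr K v))) :
    (∀ b : K, valGT (restr K v b) H →
        ∃ c : K, ((p • (δ : Γ) : Γ) : WithTop Γ) ≤ restr K v (a - F c) + restr K v b) ↔
      ∀ β ∈ above H, ∃ α ∈ distSet K v ϑ δ (valueGroup (restr K v)), p • α ≤ β := by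
  have key : ∀ (c : K) (α β : Γ), v (ϑ - algebraMap K L c) = ((δ - α : Γ) : WithTop Γ) →
      (((p • (δ : Γ) : Γ) : WithTop Γ) ≤ restr K v (a - F c) + (β : WithTop Γ) ↔
        p • α ≤ β) := by
    intro c α β hc
    rw [hF, hc, ← WithTop.coe_nsmul, ← WithTop.coe_add, WithTop.coe_le_coe, nsmul_sub,
      ← sub_nonneg, ← sub_nonneg (b := p • α)]
    congr! 1
    abel
  constructor
  · rintro h ⟨β, b, hb⟩ hβ
    obtain ⟨c, hc⟩ := h b (by
      intro γ hγ
      rw [hb, WithTop.coe_lt_coe]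
      exact hβ γ hγ)
    obtain ⟨α, hα, hα'⟩ := exists_val_sub_eq hG hϑ δ c
    rw [hb, key c _ _ hα'] at hc
    exact ⟨α, hα, hc⟩
  · intro h b hb
    by_cases hb0 : b = 0
    · exact ⟨0, by rw [hb0, AddValuation.map_zero, add_top]; exact le_top⟩
    obtain ⟨β, hβ⟩ := exists_val (restr K v) hb0
    obtain ⟨α, ⟨c, hc⟩, hle⟩ := h ⟨β, b, hβ⟩ (by
      intro γ hγ
      have := hb γ hγ
      rwa [hβ, WithTop.coe_lt_coe] at this)
    refine ⟨c, ?_⟩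
    rw [hβ, key c _ _ hc]
    exact hle

theorem defect_tfae (hp : p ≠ 0) (hG : valueGroup v = valueGroup (restr K v))
    (hϑ : ∀ c, ϑ ≠ algebraMap K L c)
    (hF : ∀ c, restr K v (a - F c) = p • v (ϑ - algebraMap K L c))
    (hID : HasIndependentDefect K v ↔ ∃ H : AddSubgroup (valueGroup (restr K v)),
      IsStronglyConvex H ∧ distSet K v ϑ δ (valueGroup (restr K v)) = above H) :
    [ HasIndependentDefect K v,
      ∃ H : AddSubgroup (valueGroup (restr K v)), IsStronglyConvex H ∧
        valSet v ϑ (Set.range (algebraMap K L)) = toValues (addSet δ (-above H)),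
      ∃ H : AddSubgroup (valueGroup (restr K v)), IsStronglyConvex H ∧
        valSet (restr K v) a (Set.range F) = toValues (addSet (p • δ) (-aboveMul p H)),
      ∃ H : AddSubgroup (valueGroup (restr K v)), IsStronglyConvex H ∧
        (∀ c : K, valLT (restr K v (a - F c) + ((-(p • (δ : Γ)) : Γ) : WithTop Γ)) H) ∧
        ∀ b : K, valGT (restr K v b) H →
          ∃ c : K, ((p • (δ : Γ) : Γ) : WithTop Γ) ≤ restr K v (a - F c) + restr K v b ].TFAE := by
  tfae_have 1 ↔ 2 := by
    rw [hID]
    refine exists_congr fun H ↦ and_congr_right fun _ ↦ ?_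
    rw [valSet_eq_toValues hG hϑ δ, toValues_injective.eq_iff, (addSet_neg_injective δ).eq_iff]
  tfae_have 1 ↔ 3 := by
    rw [hID]
    refine exists_congr fun H ↦ and_congr_right fun _ ↦ ?_
    rw [valSet_eq_mulSet hF, valSet_eq_toValues hG hϑ δ, mulSet_toValues,
      toValues_injective.eq_iff, (addSet_neg_injective _).eq_iff,
      image_nsmul_eq_aboveMul_iff hp]
  tfae_have 1 ↔ 4 := by
    rw [hID]
    refine exists_congr fun H ↦ and_congr_right fun hH ↦ ?_
    rw [eq_above_iff_coinitial hp distSet_upward hH]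
    refine and_congr ?_ (forall_coinitial_iff hG hϑ hF H).symm
    have key : ∀ c α, v (ϑ - algebraMap K L c) = ((δ - α : Γ) : WithTop Γ) →
        restr K v (a - F c) + ((-(p • (δ : Γ)) : Γ) : WithTop Γ) =
          ((-(p • α) : Γ) : WithTop Γ) := by
      intro c α hc
      rw [hF, hc, ← WithTop.coe_nsmul, ← WithTop.coe_add]
      congr 1
      rw [nsmul_sub]
      abel
    constructor
    · intro h c β hβ
      obtain ⟨α, hα, hc⟩ := exists_val_sub_eq hG hϑ δ c
      rw [key c _ hc, WithTop.coe_lt_coe]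
      have h1 := (nsmul_mem_above_iff hp).mpr (h hα) (-β) (H.neg_mem hβ)
      exact neg_lt.mp h1
    · rintro h α ⟨c, hc⟩
      rw [← nsmul_mem_above_iff hp]
      intro β hβ
      have h1 := h c (-β) (H.neg_mem hβ)
      rw [key c _ hc, WithTop.coe_lt_coe] at h1
      exact neg_lt_neg_iff.mp h1
  tfae_finish

theorem defect_divisible_tfae (hp : 2 ≤ p) (hG : valueGroup v = valueGroup (restr K v))
    (hϑ : ∀ c, ϑ ≠ algebraMap K L c)
    (hlt : ∀ c : K, v (ϑ - algebraMap K L c) < ((δ : Γ) : WithTop Γ))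
    (hF : ∀ c, restr K v (a - F c) = p • v (ϑ - algebraMap K L c))
    (hID : HasIndependentDefect K v ↔ ∃ H : AddSubgroup (valueGroup (restr K v)),
      IsStronglyConvex H ∧ distSet K v ϑ δ (valueGroup (restr K v)) = above H)
    {w : WithTop Γ} (hw : w = ((((p - 1) • δ : valueGroup (restr K v)) : Γ) : WithTop Γ))
    (hdiv : IsPDivisible p (valueGroup (restr K v))) :
    [ HasIndependentDefect K v,
      mulSet p (valSet v ϑ (Set.range (algebraMap K L))) =
        addSet w (valSet v ϑ (Set.range (algebraMap K L))),
      valSet (restr K v) a (Set.range F) =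
        addSet w (valSet v ϑ (Set.range (algebraMap K L))) ].TFAE := by
  rw [valSet_eq_mulSet hF]
  have hne : (distSet K v ϑ δ (valueGroup (restr K v))).Nonempty := by
    obtain ⟨α, hα, -⟩ := exists_val_sub_eq hG hϑ δ 0
    exact ⟨α, hα⟩
  -- Since `w + δ = p δ`, the equation `p(δ - A) = w + (δ - A)` amounts to `pA = A`.
  tfae_have 1 ↔ 2 := by
    rw [hID, exists_eq_above_iff_mulSet_eq hp hdiv hne (distSet_pos hlt) distSet_upward,
      valSet_eq_toValues hG hϑ δ, mulSet_toValues, hw, addSet_toValues, ← succ_nsmul,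
      Nat.sub_add_cancel (by omega), toValues_injective.eq_iff, (addSet_neg_injective _).eq_iff]
  tfae_have 2 ↔ 3 := Iff.rfl
  tfae_finish

theorem defect_rankOne_tfae (hp : 2 ≤ p) (hG : valueGroup v = valueGroup (restr K v))
    (hϑ : ∀ c, ϑ ≠ algebraMap K L c)
    (hlt : ∀ c : K, v (ϑ - algebraMap K L c) < ((δ : Γ) : WithTop Γ))
    (hF : ∀ c, restr K v (a - F c) = p • v (ϑ - algebraMap K L c))
    (hID : HasIndependentDefect K v ↔ ∃ H : AddSubgroup (valueGroup (restr K v)),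
      IsStronglyConvex H ∧ distSet K v ϑ δ (valueGroup (restr K v)) = above H)
    (hr : IsRankOne (valueGroup (restr K v))) :
    [ HasIndependentDefect K v,
      ∃ H : AddSubgroup (valueGroup (restr K v)), IsStronglyConvex H ∧
        ∀ b : K, valGT (restr K v b) H →
          ∃ c : K, ((p • (δ : Γ) : Γ) : WithTop Γ) ≤ restr K v (a - F c) + restr K v b,
      ∀ b : K, 0 < restr K v b →
        ∃ c : K, ((p • (δ : Γ) : Γ) : WithTop Γ) ≤
          restr K v (a - F c) + restr K v b ].TFAE := by
  have hp0 : p ≠ 0 := by omega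
  have h := rankOne_tfae hr hp (distSet_pos hlt) distSet_upward
  have h2 := exists_congr fun H : AddSubgroup (valueGroup (restr K v)) ↦
    and_congr_right fun _ : IsStronglyConvex H ↦
      forall_coinitial_iff (δ := δ) hG hϑ hF H
  have h3 := forall_coinitial_iff (δ := δ) hG hϑ hF ⊥
  simp only [mem_above_bot] at h3
  have hbot : ∀ b : K, valGT (restr K v b) (⊥ : AddSubgroup (valueGroup (restr K v))) ↔
      0 < restr K v b := by
    intro b
    simp [valGT]
  simp only [hbot] at h3
  rw [hID, h2, h3]
  exact h

end Valued

/-! ### Integers, roots of unity and generators in a valued field. -/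

section Valued
variable {Γ : Type*} [AddCommGroup Γ] [LinearOrder Γ] [IsOrderedAddMonoid Γ]

theorem val_natCast_nonneg {F : Type*} [Field F] (v : AddValuation F (WithTop Γ)) (n : ℕ) :
    0 ≤ v (n : F) := by
  induction n with
  | zero => simp
  | succ n ih =>
    rw [Nat.cast_succ]
    exact v.map_le_add ih v.map_one.ge

theorem val_intCast_nonneg {F : Type*} [Field F] (v : AddValuation F (WithTop Γ)) (n : ℤ) :
    0 ≤ v (n : F) := by
  rcases Int.eq_nat_or_neg n with ⟨m, rfl | rfl⟩
  · simpa using val_natCast_nonneg v m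
  · simpa using val_natCast_nonneg v m

/-- In residue characteristic `p`, the integers `1, …, p - 1` are units. -/
theorem val_natCast_eq_zero {F : Type*} [Field F] {v : AddValuation F (WithTop Γ)} {p : ℕ}
    (hp : p.Prime) (hvp : 0 < v (p : F)) (i : ℕ) (hi : 0 < i) (hip : i < p) : v (i : F) = 0 := by
  refine le_antisymm ?_ (val_natCast_nonneg v i)
  by_contra! hvi
  have hb := Nat.gcd_eq_gcd_ab p i
  rw [Nat.coprime_of_lt_prime hi.ne' hip hp] at hb
  have h1 : (1 : F) = p * (p.gcdA i : ℤ) + i * (p.gcdB i : ℤ) := by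
    simpa using congrArg (Int.cast : ℤ → F) hb
  have h2 : 0 < v (1 : F) := by
    rw [h1]
    apply v.map_lt_add <;> rw [v.map_mul]
    · exact hvp.trans_le (le_add_of_nonneg_right (val_intCast_nonneg v _))
    · exact hvi.trans_le (le_add_of_nonneg_right (val_intCast_nonneg v _))
  rw [v.map_one] at h2
  exact lt_irrefl _ h2

theorem val_eq_zero_of_pow_eq_one {F : Type*} [Field F] {v : AddValuation F (WithTop Γ)} {n : ℕ}
    (hn : n ≠ 0) {x : F} (hx : x ^ n = 1) : v x = 0 := by
  apply nsmul_coe_injective hn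
  rw [← v.map_pow, hx, v.map_one, nsmul_zero]

variable {K L : Type*} [Field K] [Field L] [Algebra K L] {v : AddValuation L (WithTop Γ)} {p : ℕ}
  {ϑ : L}

theorem ne_algebraMap_of_adjoin_eq_top (hdeg : 1 < Module.finrank K L) (hϑ : K⟮ϑ⟯ = ⊤) (c : K) :
    ϑ ≠ algebraMap K L c := by
  rintro rfl
  rw [IntermediateField.adjoin_simple_eq_bot_iff.mpr (IntermediateField.algebraMap_mem _ c)] at hϑ
  have h1 := IntermediateField.finrank_top' (F := K) (E := L)
  rw [← hϑ, IntermediateField.finrank_bot] at h1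
  omega

/-- As `σ` preserves values, `v(ϑ - d) ≤ v(σ ϑ - ϑ)` for every `d`; strictness holds because `v(ϑ -
K)` has no maximum. -/
theorem IsDefectExtension.val_sub_lt (hE : IsDefectExtension K v)
    (hp : (Module.finrank K L).Prime) (hϑ : ∀ c, ϑ ≠ algebraMap K L c)
    {σ : L ≃ₐ[K] L} {δ : Γ} (hσ : v (σ ϑ - ϑ) = δ) (c : K) :
    v (ϑ - algebraMap K L c) < (δ : WithTop Γ) := by
  have := hE.finite
  by_contra! h
  obtain ⟨d, hd⟩ := hE.exists_val_sub_lt hp (x := ϑ) (by rintro ⟨c, hc⟩; exact hϑ c hc.symm) c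
  have h1 : σ ϑ - ϑ = σ (ϑ - algebraMap K L d) - (ϑ - algebraMap K L d) := by
    rw [map_sub, AlgEquiv.commutes, sub_sub_sub_cancel_right]
  have h2 : v (ϑ - algebraMap K L d) ≤ v (σ ϑ - ϑ) := by
    rw [h1]
    exact v.map_le_sub (hE.unibranched.val_algEquiv σ _).ge le_rfl
  rw [hσ] at h2
  exact absurd (h.trans_lt (hd.trans_le h2)) (lt_irrefl _)

/-- The set `Σ_σ` of a Galois defect extension `K(ϑ)|K` of prime degree, in terms of `v(ϑ - K)`. -/
theorem IsDefectExtension.sigmaSet_eq_distSet (hE : IsDefectExtension K v) (hp : p.Prime)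
    (hdeg : Module.finrank K L = p) (hvp : 0 < v (p : L)) (hϑ : K⟮ϑ⟯ = ⊤)
    {h : K[X]} (hhp : h.natDegree = p)
    (hh : ∀ c, restr K v (h.eval c) = p • v (ϑ - algebraMap K L c))
    {σ : L ≃ₐ[K] L} {δ : Γ} (hσ : v (σ ϑ - ϑ) = δ) :
    sigmaSet v σ = distSet K v ϑ δ (valueGroup v) := by
  have := hE.finite
  have hp' : (Module.finrank K L).Prime := hdeg ▸ hp
  have hne := ne_algebraMap_of_adjoin_eq_top hp'.one_lt hϑ
  choose g hg using fun c ↦ exists_val v (sub_ne_zero.mpr (hne c))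
  have hmax : ∀ c, ∃ d, g c < g d := by
    intro c
    obtain ⟨d, hd⟩ := hE.exists_val_sub_lt hp' (x := ϑ)
      (by rintro ⟨c, hc⟩; exact hne c hc.symm) c
    rw [hg, hg, WithTop.coe_lt_coe] at hd
    exact ⟨d, hd⟩
  ext γ
  rw [mem_sigmaSet_iff hdeg hϑ hg hmax (val_natCast_eq_zero hp hvp) _ hhp _ σ hσ]
  · exact exists_congr fun c ↦ by rw [hg, WithTop.coe_inj]
  · intro c
    have := hE.val_sub_lt hp' hne hσ c
    rw [hg, WithTop.coe_lt_coe] at this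
    exact this.le
  · intro c γ hγ hle
    rw [hE.valueGroup_eq hp'] at hγ
    obtain ⟨d, hd⟩ := exists_val_sub_eq_of_le hγ (c := c) (v := v) (ϑ := ϑ)
      (by rw [hg]; exact WithTop.coe_le_coe.mpr hle)
    rw [hg, WithTop.coe_inj] at hd
    exact ⟨d, hd⟩
  · intro c
    rw [aeval_algebraMap_apply_eq_algebraMap_eval, ← restr_apply, hh, hg, WithTop.coe_nsmul]

theorem algEquiv_apply_ne_of_ne_one [FiniteDimensional K L] (hϑ : K⟮ϑ⟯ = ⊤) {σ : L ≃ₐ[K] L}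
    (hσ : σ ≠ 1) : σ ϑ ≠ ϑ := by
  intro h
  apply hσ
  ext x
  obtain ⟨f, -, rfl⟩ := exists_aeval_eq_of_adjoin_eq_top hϑ x
  have h1 : σ (aeval ϑ f) = aeval (σ ϑ) f := (aeval_algHom_apply σ ϑ f).symm
  rw [h1, h, AlgEquiv.one_apply]

end Valued

/-! ### Artin–Schreier generators. -/

section ArtinSchreier
variable {Γ : Type*} [AddCommGroup Γ] [LinearOrder Γ] [IsOrderedAddMonoid Γ]
variable {K L : Type*} [Field K] [Field L] [Algebra K L] {v : AddValuation L (WithTop Γ)} {p : ℕ}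
  {ϑ : L} {a : K}

theorem natDegree_X_pow_sub_X_sub_C (hp : 1 < p) : (X ^ p - X - C a).natDegree = p := by
  rw [natDegree_sub_C, FiniteField.X_pow_card_sub_X_natDegree_eq K hp]

theorem exists_algEquiv_ne_one_of_artinSchreier [FiniteDimensional K L] (hp : p.Prime)
    (hdeg : Module.finrank K L = p) [CharP K p] (hϑ : K⟮ϑ⟯ = ⊤)
    (ha : ϑ ^ p - ϑ = algebraMap K L a) : ∃ σ : L ≃ₐ[K] L, σ ≠ 1 := by
  have : Fact p.Prime := ⟨hp⟩
  have : CharP L p := charP_of_injective_algebraMap (algebraMap K L).injective p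
  have hint : IsIntegral K ϑ := Algebra.IsIntegral.isIntegral ϑ
  have hdvd : minpoly K ϑ ∣ X ^ p - X - C a := by
    apply minpoly.dvd
    simp [ha]
  have hmonic : (X ^ p - X - C a : K[X]).Monic := by
    rw [sub_sub]
    exact monic_X_pow_sub (by rw [degree_X_add_C]; exact_mod_cast hp.one_lt)
  have hmin : X ^ p - X - C a = minpoly K ϑ :=
    eq_of_monic_of_dvd_of_natDegree_le (minpoly.monic hint) hmonic hdvd
      (by rw [natDegree_X_pow_sub_X_sub_C hp.one_lt, natDegree_minpoly_of_adjoin_eq_top hϑ, hdeg])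
  have hroot : aeval (ϑ + 1) (minpoly K ϑ) = 0 := by
    rw [← hmin]
    simp only [map_sub, map_pow, aeval_X, aeval_C, add_pow_char, one_pow, ← ha]
    ring
  let φ : K⟮ϑ⟯ →ₐ[K] L := (IntermediateField.adjoin.powerBasis hint).lift (ϑ + 1) (by
    rw [IntermediateField.adjoin.powerBasis_gen, IntermediateField.minpoly_gen]
    exact hroot)
  have hφ : φ (IntermediateField.AdjoinSimple.gen K ϑ) = ϑ + 1 := by
    rw [← IntermediateField.adjoin.powerBasis_gen hint]
    exact PowerBasis.lift_gen _ _ _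
  let e : L ≃ₐ[K] K⟮ϑ⟯ := (IntermediateField.topEquiv.symm).trans (IntermediateField.equivOfEq hϑ.symm)
  have he : e ϑ = IntermediateField.AdjoinSimple.gen K ϑ := rfl
  let σ : L ≃ₐ[K] L := AlgEquiv.ofBijective (φ.comp (e : L →ₐ[K] K⟮ϑ⟯))
    (Algebra.IsAlgebraic.algHom_bijective _)
  refine ⟨σ, fun h ↦ ?_⟩
  have h1 : σ ϑ = ϑ + 1 := hφ
  rw [h, AlgEquiv.one_apply] at h1
  exact one_ne_zero (left_eq_add.mp h1)

/-- The difference `σ ϑ - ϑ` is a nonzero root of `X ^ p - X`, hence a root of unity. -/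
theorem val_algEquiv_sub_of_artinSchreier [FiniteDimensional K L] (hp : p.Prime) [CharP K p] (hϑ : K⟮ϑ⟯ = ⊤)
    (ha : ϑ ^ p - ϑ = algebraMap K L a) {σ : L ≃ₐ[K] L} (hσ : σ ≠ 1) :
    v (σ ϑ - ϑ) = ((0 : Γ) : WithTop Γ) := by
  have : Fact p.Prime := ⟨hp⟩
  have : CharP L p := charP_of_injective_algebraMap (algebraMap K L).injective p
  have hne := sub_ne_zero.mpr (algEquiv_apply_ne_of_ne_one hϑ hσ)
  have h1 : (σ ϑ) ^ p - σ ϑ = algebraMap K L a := by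
    rw [← map_pow, ← map_sub, ha, AlgEquiv.commutes]
  have h2 : (σ ϑ - ϑ) ^ p = σ ϑ - ϑ := by
    rw [sub_pow_char]
    linear_combination h1 - ha
  have h3 : (σ ϑ - ϑ) ^ (p - 1) = 1 := by
    apply mul_right_cancel₀ hne
    rw [← pow_succ, Nat.sub_add_cancel hp.one_le, h2, one_mul]
  exact val_eq_zero_of_pow_eq_one (Nat.sub_ne_zero_of_lt hp.one_lt) h3

/-- By additivity `a - ℘(c) = ℘(ϑ - c)`, and the `p`-th power dominates at negative value. -/
theorem restr_sub_wp (hp : p.Prime) [CharP K p] (ha : ϑ ^ p - ϑ = algebraMap K L a) {c : K}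
    (hc : v (ϑ - algebraMap K L c) < 0) :
    restr K v (a - wp p c) = p • v (ϑ - algebraMap K L c) := by
  have : Fact p.Prime := ⟨hp⟩
  have : CharP L p := charP_of_injective_algebraMap (algebraMap K L).injective p
  have h1 : algebraMap K L (a - wp p c) =
      (ϑ - algebraMap K L c) ^ p - (ϑ - algebraMap K L c) := by
    rw [wp, map_sub, map_sub, map_pow, ← ha, sub_pow_char]
    ring
  rw [restr_apply, h1, v.map_sub_eq_of_lt_left, v.map_pow]
  rw [v.map_pow]
  generalize v (ϑ - algebraMap K L c) = t at hc
  induction t using WithTop.recTopCoe with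
  | top => simp at hc
  | coe t =>
    norm_cast at hc ⊢
    obtain ⟨m, rfl⟩ := Nat.exists_eq_add_of_le' hp.two_le
    have h2 := nsmul_pos (neg_pos.mpr hc) (Nat.succ_ne_zero m)
    rw [smul_neg, neg_pos] at h2
    rw [succ_nsmul]
    exact add_lt_of_neg_left t h2

end ArtinSchreier

/-! ### Roots of unity and Kummer generators. -/

section Kummer
variable {Γ : Type*} [AddCommGroup Γ] [LinearOrder Γ] [IsOrderedAddMonoid Γ]

theorem val_sub_one_le_val_pow_sub_one {F : Type*} [Field F] (v : AddValuation F (WithTop Γ))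
    {x : F} (hx : 0 ≤ v x) (k : ℕ) : v (x - 1) ≤ v (x ^ k - 1) := by
  rw [← mul_geom_sum, v.map_mul]
  refine le_add_of_nonneg_right (v.map_le_sum fun i _ ↦ ?_)
  rw [v.map_pow]
  exact nsmul_nonneg hx _

theorem val_sub_one_eq_of_isPrimitiveRoot {F : Type*} [Field F] (v : AddValuation F (WithTop Γ))
    {n : ℕ} (hn : n ≠ 0) {x y : F} (hx : IsPrimitiveRoot x n) (hy : IsPrimitiveRoot y n) :
    v (x - 1) = v (y - 1) := by
  have : NeZero n := ⟨hn⟩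
  apply le_antisymm
  · obtain ⟨i, -, rfl⟩ := hx.eq_pow_of_pow_eq_one hy.pow_eq_one
    exact val_sub_one_le_val_pow_sub_one v (val_eq_zero_of_pow_eq_one hn hx.pow_eq_one).ge i
  · obtain ⟨i, -, rfl⟩ := hy.eq_pow_of_pow_eq_one hx.pow_eq_one
    exact val_sub_one_le_val_pow_sub_one v (val_eq_zero_of_pow_eq_one hn hy.pow_eq_one).ge i

/-- `v p = (p - 1) v (ζ - 1)` for a primitive `p`-th root of unity `ζ`. -/
theorem val_natCast_eq_of_isPrimitiveRoot {F : Type*} [Field F] (v : AddValuation F (WithTop Γ))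
    {p : ℕ} (hp : p.Prime) {ζ : F} (hζ : IsPrimitiveRoot ζ p) :
    v (p : F) = (p - 1) • v (ζ - 1) := by
  obtain ⟨n, rfl⟩ := Nat.exists_eq_add_of_le' hp.one_le
  -- `p` is the product of the `1 - ζ ^ k` for `0 < k < p`, and all these factors have the same
  -- value.
  have h := hζ.prod_one_sub_pow_eq_order
  have h2 : ∀ s : Finset ℕ, (∀ k ∈ s, k < n) →
      v (∏ k ∈ s, (1 - ζ ^ (k + 1))) = s.card • v (ζ - 1) := by
    intro s
    induction s using Finset.cons_induction with
    | empty => simp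
    | cons k s hk ih =>
      intro hs
      rw [Finset.prod_cons, v.map_mul, ih fun i hi ↦ hs i (Finset.mem_cons_of_mem hi),
        Finset.card_cons, succ_nsmul, add_comm, v.map_sub_swap 1]
      congr 1
      have hkn := hs k (Finset.mem_cons_self k s)
      apply val_sub_one_eq_of_isPrimitiveRoot v hp.ne_zero _ hζ
      exact hζ.pow_of_coprime _
        (Nat.coprime_of_lt_prime (Nat.succ_ne_zero k) (by omega) hp).symm
  rw [Nat.cast_succ, ← h, h2 _ fun k hk ↦ Finset.mem_range.mp hk, Finset.card_range,
    Nat.add_sub_cancel]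

variable {K L : Type*} [Field K] [Field L] [Algebra K L] {v : AddValuation L (WithTop Γ)} {p : ℕ}

theorem IsUnibranched.le_val_trace [FiniteDimensional K L] [IsGalois K L]
    (hU : IsUnibranched K v) (x : L) : v x ≤ restr K v (Algebra.trace K L x) := by
  rw [restr_apply, trace_eq_sum_automorphisms]
  exact v.map_le_sum fun σ _ ↦ (hU.val_algEquiv σ x).ge

/-- Galois defect extensions of prime degree `p` have residue characteristic `p`. -/
theorem IsDefectExtension.val_natCast_pos [IsGalois K L] (hE : IsDefectExtension K v)
    (hp : p.Prime) (hdeg : Module.finrank K L = p) {x : L}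
    (hx : x ∉ Set.range (algebraMap K L)) : 0 < restr K v (p : K) := by
  have := hE.finite
  by_contra! hle
  have h0 : restr K v (p : K) = 0 := le_antisymm hle (val_natCast_nonneg _ p)
  have hp0 : (p : K) ≠ 0 := by
    intro h
    rw [h, AddValuation.map_zero] at h0
    exact WithTop.top_ne_zero h0
  -- If `vp = 0`, `x` can be shifted to trace zero. Approximating the result `y` by `d ∈ K` gives `y
  -- - d` of trace `-p d`, whose value `v y` is less than `v(y - d)`; but the trace never lowers
  -- values.
  set y := x - algebraMap K L (Algebra.trace K L x / p) with hy
  have hy0 : y ≠ 0 := fun h ↦ hx ⟨_, (sub_eq_zero.mp h).symm⟩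
  have htr : Algebra.trace K L y = 0 := by
    rw [hy, map_sub, Algebra.trace_algebraMap, hdeg, nsmul_eq_mul, mul_div_cancel₀ _ hp0, sub_self]
  obtain ⟨d, hd⟩ := hE.exists_val_lt_val_sub (hdeg ▸ hp) hy0
  have h1 : v (algebraMap K L d) = v y := by
    rw [v.map_sub_swap y] at hd
    exact v.map_eq_of_lt_sub hd
  have h2 := hE.unibranched.le_val_trace (y - algebraMap K L d)
  rw [map_sub (Algebra.trace K L), htr, Algebra.trace_algebraMap, hdeg, zero_sub, AddValuation.map_neg, nsmul_eq_mul,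
    AddValuation.map_mul, h0, zero_add, restr_apply, h1] at h2
  exact absurd (hd.trans_le h2) (lt_irrefl _)

/-- A Kummer generator `x` divided by an approximation `d ∈ K` with `v(x - d) > v x` is a `1`-unit.
-/
theorem IsDefectExtension.exists_one_unit_generator [IsGalois K L] (hE : IsDefectExtension K v)
    (hp : p.Prime) (hdeg : Module.finrank K L = p) {ζ : K} (hζ : IsPrimitiveRoot ζ p) :
    ∃ (η : L) (a : K), K⟮η⟯ = ⊤ ∧ η ^ p = algebraMap K L a ∧ 0 < v (η - 1) := by
  have := hE.finite
  have : Fact p.Prime := ⟨hp⟩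
  have : IsCyclic (L ≃ₐ[K] L) :=
    isCyclic_of_prime_card (p := p) (by rw [IsGalois.card_aut_eq_finrank, hdeg])
  have hprim : (primitiveRoots (Module.finrank K L) K).Nonempty :=
    ⟨ζ, by rw [hdeg]; exact (mem_primitiveRoots hp.pos).mpr hζ⟩
  obtain ⟨x, ⟨b, hb⟩, hx⟩ := exists_root_adjoin_eq_top_of_isCyclic K L hprim
  rw [hdeg] at hb
  have hxne := ne_algebraMap_of_adjoin_eq_top (hdeg ▸ hp.one_lt) hx
  have hx0 : x ≠ 0 := by
    rw [← map_zero (algebraMap K L)]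
    exact hxne 0
  obtain ⟨d, hd⟩ := hE.exists_val_lt_val_sub (hdeg ▸ hp) hx0
  have hvd : v (algebraMap K L d) = v x := by
    rw [v.map_sub_swap] at hd
    exact v.map_eq_of_lt_sub hd
  have hd0 : algebraMap K L d ≠ 0 := by
    rw [← v.ne_top_iff, hvd, v.ne_top_iff]
    exact hx0
  refine ⟨x / algebraMap K L d, b / d ^ p, ?_, ?_, ?_⟩
  · rw [eq_top_iff, ← hx, IntermediateField.adjoin_simple_le_iff]
    have h1 := mul_mem (IntermediateField.mem_adjoin_simple_self K (x / algebraMap K L d))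
      (IntermediateField.algebraMap_mem K⟮x / algebraMap K L d⟯ d)
    rwa [div_mul_cancel₀ _ hd0] at h1
  · rw [div_pow, map_div₀, map_pow, hb]
  · obtain ⟨γ, hγ⟩ := exists_val v hd0
    have h1 : x / algebraMap K L d - 1 = (x - algebraMap K L d) / algebraMap K L d := by
      rw [sub_div, div_self hd0]
    obtain ⟨ε, hε⟩ := exists_val v (sub_ne_zero.mpr (hxne d))
    rw [h1, val_div hε hγ]
    rw [← hvd, hγ, hε, WithTop.coe_lt_coe] at hd
    exact WithTop.coe_lt_coe.mpr (sub_pos.mpr hd)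

variable {η : L} {a : K} {δ : Γ}

theorem val_eq_zero_of_val_sub_one_pos (hη : 0 < v (η - 1)) : v η = 0 := by
  rw [← v.map_one]
  apply v.map_eq_of_lt_sub
  rwa [v.map_one]

theorem val_algEquiv_sub_of_kummer [FiniteDimensional K L] (hp : p.Prime) (hη : K⟮η⟯ = ⊤)
    (ha : η ^ p = algebraMap K L a) (h1 : 0 < v (η - 1)) {ζ : L} (hζ : IsPrimitiveRoot ζ p)
    {σ : L ≃ₐ[K] L} (hσ : σ ≠ 1) : v (σ η - η) = v (ζ - 1) := by
  have hη0 : η ≠ 0 := by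
    rw [← v.ne_top_iff, val_eq_zero_of_val_sub_one_pos h1]
    exact WithTop.zero_ne_top
  have hμ : (σ η / η) ^ p = 1 := by
    rw [div_pow, ← map_pow, ha, AlgEquiv.commutes, ← ha, div_self (pow_ne_zero _ hη0)]
  have hμ1 : σ η / η ≠ 1 := fun h ↦
    algEquiv_apply_ne_of_ne_one hη hσ ((div_eq_one_iff_eq hη0).mp h)
  have hprim : IsPrimitiveRoot (σ η / η) p := by
    have : Fact p.Prime := ⟨hp⟩
    rw [IsPrimitiveRoot.iff_orderOf]
    exact orderOf_eq_prime hμ hμ1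
  have h2 : σ η - η = (σ η / η - 1) * η := by
    rw [sub_mul, div_mul_cancel₀ _ hη0, one_mul]
  rw [h2, v.map_mul, val_eq_zero_of_val_sub_one_pos h1, add_zero]
  exact val_sub_one_eq_of_isPrimitiveRoot v hp.ne_zero hprim hζ

/-- In `a - c ^ p = ∏ (η - μ c)`, over the `p`-th roots of unity `μ`, all factors have value `v(η -
c)`. If `vc < 0`, each has value `vc`; otherwise `(μ - 1) c` has value at least `v(ζ - 1) > v(η -
c)`. -/
theorem restr_sub_pow (hp : p.Prime) (ha : η ^ p = algebraMap K L a) (h1 : 0 < v (η - 1))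
    {ζ : L} (hζ : IsPrimitiveRoot ζ p) {c : K}
    (hc : v (η - algebraMap K L c) < v (ζ - 1)) :
    restr K v (a - c ^ p) = p • v (η - algebraMap K L c) := by
  have hη := val_eq_zero_of_val_sub_one_pos h1
  set y := algebraMap K L c
  have key : ∀ μ : L, μ ^ p = 1 → v (η - μ * y) = v (η - y) := by
    intro μ hμ
    have hμ0 := val_eq_zero_of_pow_eq_one (v := v) hp.ne_zero hμ
    rcases lt_or_ge (v y) 0 with hy | hy
    · have h2 : ∀ z, v z = v y → v (η - z) = v y := by
        intro z hz
        rw [v.map_sub_swap, v.map_sub_eq_of_lt_left, hz]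
        rwa [hz, hη]
      rw [h2 y rfl, h2 (μ * y)]
      rw [v.map_mul, hμ0, zero_add]
    · obtain ⟨i, -, rfl⟩ := (have : NeZero p := ⟨hp.ne_zero⟩
        hζ.eq_pow_of_pow_eq_one hμ)
      have h2 : η - ζ ^ i * y = (η - y) - (ζ ^ i - 1) * y := by ring
      rw [h2]
      apply v.map_sub_eq_of_lt_left
      rw [v.map_mul]
      refine hc.trans_le (le_add_of_le_of_nonneg ?_ hy)
      exact val_sub_one_le_val_pow_sub_one v
        (val_eq_zero_of_pow_eq_one hp.ne_zero hζ.pow_eq_one).ge i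
  have h2 : algebraMap K L (a - c ^ p) =
      ∏ μ ∈ nthRootsFinset p (1 : L), (η - μ * y) := by
    rw [← hζ.pow_sub_pow_eq_prod_sub_mul η y hp.pos, map_sub, map_pow, ha]
  have h3 : ∀ s : Finset L, (∀ μ ∈ s, μ ^ p = 1) →
      v (∏ μ ∈ s, (η - μ * y)) = s.card • v (η - y) := by
    intro s
    induction s using Finset.cons_induction with
    | empty => simp
    | cons μ s hμ ih =>
      intro hs
      rw [Finset.prod_cons, v.map_mul, ih fun i hi ↦ hs i (Finset.mem_cons_of_mem hi),
        Finset.card_cons, succ_nsmul, add_comm, key μ (hs μ (Finset.mem_cons_self μ s))]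
  rw [restr_apply, h2, h3 _ fun μ hμ ↦ (mem_nthRootsFinset hp.pos 1).mp hμ,
    hζ.card_nthRootsFinset]

end Kummer

end DefectExt

end

/-! ### The two cases: `δ = 0` for Artin–Schreier, `δ = v(ζ - 1)` for Kummer. -/

theorem theorem1p4
    {Γ : Type*} [AddCommGroup Γ] [LinearOrder Γ] [IsOrderedAddMonoid Γ]
    {K L : Type*} [Field K] [Field L] [Algebra K L]
    (v : AddValuation L (WithTop Γ))
    (p : ℕ) (hp : p.Prime) (hdeg : Module.finrank K L = p)
    (hE : DefectExt.IsDefectExtension K v) :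
    DefectExt.valueGroup v = DefectExt.valueGroup (DefectExt.restr K v) ∧
    -- the Artin-Schreier case
    (CharP K p → ∀ (ϑ : L) (a : K), K⟮ϑ⟯ = ⊤ → ϑ ^ p - ϑ = algebraMap K L a →
      (∀ c : K, v (ϑ - algebraMap K L c) < 0 ∧
        DefectExt.restr K v (a - DefectExt.wp p c) = p • v (ϑ - algebraMap K L c)) ∧
      DefectExt.valSet (DefectExt.restr K v) a (Set.range (DefectExt.wp p)) =
        DefectExt.mulSet p (DefectExt.valSet v ϑ (Set.range (algebraMap K L))) ∧
      [ DefectExt.HasIndependentDefect K v,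
        ∃ H : AddSubgroup (DefectExt.valueGroup (DefectExt.restr K v)),
          DefectExt.IsStronglyConvex H ∧
          DefectExt.valSet v ϑ (Set.range (algebraMap K L)) =
            DefectExt.toValues (-DefectExt.above H),
        ∃ H : AddSubgroup (DefectExt.valueGroup (DefectExt.restr K v)),
          DefectExt.IsStronglyConvex H ∧
          DefectExt.valSet (DefectExt.restr K v) a (Set.range (DefectExt.wp p)) =
            DefectExt.toValues (-DefectExt.aboveMul p H),
        ∃ H : AddSubgroup (DefectExt.valueGroup (DefectExt.restr K v)),
          DefectExt.IsStronglyConvex H ∧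
          (∀ c : K, DefectExt.valLT (DefectExt.restr K v (a - DefectExt.wp p c)) H) ∧
          ∀ b : K, DefectExt.valGT (DefectExt.restr K v b) H →
            ∃ c : K, 0 ≤ DefectExt.restr K v (a - DefectExt.wp p c) + DefectExt.restr K v b
      ].TFAE ∧
      (DefectExt.IsPDivisible p (DefectExt.valueGroup (DefectExt.restr K v)) →
        [ DefectExt.HasIndependentDefect K v,
          DefectExt.mulSet p (DefectExt.valSet v ϑ (Set.range (algebraMap K L))) =
            DefectExt.valSet v ϑ (Set.range (algebraMap K L)),
          DefectExt.valSet (DefectExt.restr K v) a (Set.range (DefectExt.wp p)) =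
            DefectExt.valSet v ϑ (Set.range (algebraMap K L))
        ].TFAE) ∧
      (DefectExt.IsRankOne (DefectExt.valueGroup (DefectExt.restr K v)) →
        [ DefectExt.HasIndependentDefect K v,
          ∃ H : AddSubgroup (DefectExt.valueGroup (DefectExt.restr K v)),
            DefectExt.IsStronglyConvex H ∧
            ∀ b : K, DefectExt.valGT (DefectExt.restr K v b) H →
              ∃ c : K, 0 ≤ DefectExt.restr K v (a - DefectExt.wp p c) + DefectExt.restr K v b,
          ∀ b : K, 0 < DefectExt.restr K v b →
            ∃ c : K, 0 ≤ DefectExt.restr K v (a - DefectExt.wp p c) + DefectExt.restr K v b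
        ].TFAE)) ∧
    -- the Kummer case
    (IsGalois K L → ∀ ζ : K, IsPrimitiveRoot ζ p →
      (∃ (η : L) (a : K), K⟮η⟯ = ⊤ ∧ η ^ p = algebraMap K L a ∧ 0 < v (η - 1)) ∧
      -- `δ` is the value `vp / (p - 1)`
      ∃ δ : DefectExt.valueGroup (DefectExt.restr K v),
        DefectExt.restr K v (p : K) = ((((p - 1) • δ : DefectExt.valueGroup _) : Γ) : WithTop Γ) ∧
        ∀ (η : L) (a : K), K⟮η⟯ = ⊤ → η ^ p = algebraMap K L a → 0 < v (η - 1) →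
          (∀ c : K, v (η - algebraMap K L c) < ((δ : Γ) : WithTop Γ) ∧
            DefectExt.restr K v (a - c ^ p) = p • v (η - algebraMap K L c)) ∧
          DefectExt.valSet (DefectExt.restr K v) a (Set.range (fun c => c ^ p)) =
            DefectExt.mulSet p (DefectExt.valSet v η (Set.range (algebraMap K L))) ∧
          [ DefectExt.HasIndependentDefect K v,
            ∃ H : AddSubgroup (DefectExt.valueGroup (DefectExt.restr K v)),
              DefectExt.IsStronglyConvex H ∧
              DefectExt.valSet v η (Set.range (algebraMap K L)) =
                DefectExt.toValues (DefectExt.addSet δ (-DefectExt.above H)),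
            ∃ H : AddSubgroup (DefectExt.valueGroup (DefectExt.restr K v)),
              DefectExt.IsStronglyConvex H ∧
              DefectExt.valSet (DefectExt.restr K v) a (Set.range (fun c => c ^ p)) =
                DefectExt.toValues (DefectExt.addSet (p • δ) (-DefectExt.aboveMul p H)),
            ∃ H : AddSubgroup (DefectExt.valueGroup (DefectExt.restr K v)),
              DefectExt.IsStronglyConvex H ∧
              (∀ c : K, DefectExt.valLT
                (DefectExt.restr K v (a - c ^ p) + ((-(p • (δ : Γ)) : Γ) : WithTop Γ)) H) ∧
              ∀ b : K, DefectExt.valGT (DefectExt.restr K v b) H →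
                ∃ c : K, ((p • (δ : Γ) : Γ) : WithTop Γ) ≤
                  DefectExt.restr K v (a - c ^ p) + DefectExt.restr K v b
          ].TFAE ∧
          (DefectExt.IsPDivisible p (DefectExt.valueGroup (DefectExt.restr K v)) →
            [ DefectExt.HasIndependentDefect K v,
              DefectExt.mulSet p (DefectExt.valSet v η (Set.range (algebraMap K L))) =
                DefectExt.addSet (DefectExt.restr K v (p : K))
                  (DefectExt.valSet v η (Set.range (algebraMap K L))),
              DefectExt.valSet (DefectExt.restr K v) a (Set.range (fun c => c ^ p)) =
                DefectExt.addSet (DefectExt.restr K v (p : K))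
                  (DefectExt.valSet v η (Set.range (algebraMap K L)))
            ].TFAE) ∧
          (DefectExt.IsRankOne (DefectExt.valueGroup (DefectExt.restr K v)) →
            [ DefectExt.HasIndependentDefect K v,
              ∃ H : AddSubgroup (DefectExt.valueGroup (DefectExt.restr K v)),
                DefectExt.IsStronglyConvex H ∧
                ∀ b : K, DefectExt.valGT (DefectExt.restr K v b) H →
                  ∃ c : K, ((p • (δ : Γ) : Γ) : WithTop Γ) ≤
                    DefectExt.restr K v (a - c ^ p) + DefectExt.restr K v b,
              ∀ b : K, 0 < DefectExt.restr K v b →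
                ∃ c : K, ((p • (δ : Γ) : Γ) : WithTop Γ) ≤
                  DefectExt.restr K v (a - c ^ p) + DefectExt.restr K v b
            ].TFAE)) := by
  have := hE.finite
  have hp' : (Module.finrank K L).Prime := hdeg ▸ hp
  have hG := hE.valueGroup_eq hp'
  refine ⟨hG, ?_, ?_⟩
  · intro hchar ϑ a hϑ ha
    have hne := DefectExt.ne_algebraMap_of_adjoin_eq_top hp'.one_lt hϑ
    obtain ⟨τ, hτ⟩ := DefectExt.exists_algEquiv_ne_one_of_artinSchreier hp hdeg hϑ ha
    have hσ : ∀ σ : L ≃ₐ[K] L, σ ≠ 1 → v (σ ϑ - ϑ) = ((0 : Γ) : WithTop Γ) :=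
      fun σ h ↦ DefectExt.val_algEquiv_sub_of_artinSchreier hp hϑ ha h
    have hlt := hE.val_sub_lt hp' hne (hσ τ hτ)
    have hF : ∀ c, DefectExt.restr K v (a - DefectExt.wp p c) = p • v (ϑ - algebraMap K L c) :=
      fun c ↦ DefectExt.restr_sub_wp hp ha (hlt c)
    have hvp : 0 < v (p : L) := by
      rw [← map_natCast (algebraMap K L), CharP.cast_eq_zero, map_zero, v.map_zero]
      exact WithTop.coe_lt_top 0
    -- The auxiliary polynomial of degree `p` is `X ^ p - X - a`, whose value at `c` is `-(a -
    -- ℘(c))`.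
    have hID := DefectExt.hasIndependentDefect_iff (δ := 0) hG ⟨τ, hτ⟩ fun σ h ↦
      hE.sigmaSet_eq_distSet hp hdeg hvp hϑ
        (DefectExt.natDegree_X_pow_sub_X_sub_C (a := a) hp.one_lt) (fun c ↦ by
          rw [← hF, ← AddValuation.map_neg]
          simp [DefectExt.wp]) (hσ σ h)
    refine ⟨fun c ↦ ⟨hlt c, hF c⟩, DefectExt.valSet_eq_mulSet hF, ?_, fun hdiv ↦ ?_, fun hr ↦ ?_⟩
    · simpa [DefectExt.addSet_zero] using DefectExt.defect_tfae hp.ne_zero hG hne hF hID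
    · simpa [DefectExt.addSet_zero] using
        DefectExt.defect_divisible_tfae hp.two_le hG hne hlt hF hID (w := 0) (by simp) hdiv
    · simpa using DefectExt.defect_rankOne_tfae hp.two_le hG hne hlt hF hID hr
  · intro hGal ζ hζ
    have hζL : IsPrimitiveRoot (algebraMap K L ζ) p :=
      hζ.map_of_injective (algebraMap K L).injective
    obtain ⟨η₀, a₀, hη₀, ha₀, h₀⟩ := hE.exists_one_unit_generator hp hdeg hζ
    refine ⟨⟨η₀, a₀, hη₀, ha₀, h₀⟩, ?_⟩
    obtain ⟨δ, hδ⟩ := DefectExt.exists_val (DefectExt.restr K v)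
      (sub_ne_zero.mpr (hζ.ne_one hp.one_lt))
    have hδL : v (algebraMap K L ζ - 1) = δ := by
      rw [← hδ, DefectExt.restr_apply, map_sub (algebraMap K L), map_one (algebraMap K L)]
    have hw : DefectExt.restr K v (p : K) =
        ((((p - 1) • ⟨δ, ζ - 1, hδ⟩ : DefectExt.valueGroup (DefectExt.restr K v)) : Γ) :
          WithTop Γ) := by
      rw [DefectExt.val_natCast_eq_of_isPrimitiveRoot _ hp hζ, hδ, ← WithTop.coe_nsmul]
      rfl
    refine ⟨⟨δ, ζ - 1, hδ⟩, hw, ?_⟩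
    intro η a hη ha h1
    have hne := DefectExt.ne_algebraMap_of_adjoin_eq_top hp'.one_lt hη
    have hvp : 0 < v (p : L) := by
      have := hE.val_natCast_pos hp hdeg (x := η) (by rintro ⟨c, hc⟩; exact hne c hc.symm)
      rwa [DefectExt.restr_apply, map_natCast] at this
    have hcard : 1 < Nat.card (L ≃ₐ[K] L) := by
      rw [IsGalois.card_aut_eq_finrank]
      exact hp'.one_lt
    have : Nontrivial (L ≃ₐ[K] L) := Finite.one_lt_card_iff_nontrivial.mp hcard
    obtain ⟨τ, hτ⟩ := exists_ne (1 : L ≃ₐ[K] L)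
    have hσ : ∀ σ : L ≃ₐ[K] L, σ ≠ 1 → v (σ η - η) = (δ : WithTop Γ) :=
      fun σ h ↦ (DefectExt.val_algEquiv_sub_of_kummer hp hη ha h1 hζL h).trans hδL
    have hlt := hE.val_sub_lt hp' hne (hσ τ hτ)
    have hF : ∀ c, DefectExt.restr K v (a - c ^ p) = p • v (η - algebraMap K L c) :=
      fun c ↦ DefectExt.restr_sub_pow hp ha h1 hζL ((hlt c).trans_eq hδL.symm)
    have hID := DefectExt.hasIndependentDefect_iff (δ := ⟨δ, ζ - 1, hδ⟩) hG ⟨τ, hτ⟩ fun σ h ↦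
      hE.sigmaSet_eq_distSet hp hdeg hvp hη
        (Polynomial.natDegree_X_pow_sub_C (n := p) (r := a)) (fun c ↦ by
          rw [← hF, ← AddValuation.map_neg]
          simp) (hσ σ h)
    exact ⟨fun c ↦ ⟨hlt c, hF c⟩, DefectExt.valSet_eq_mulSet hF,
      DefectExt.defect_tfae hp.ne_zero hG hne hF hID,
      DefectExt.defect_divisible_tfae hp.two_le hG hne hlt hF hID hw,
      DefectExt.defect_rankOne_tfae hp.two_le hG hne hlt hF hID⟩
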